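/- Let $n\ge 1$ and let $q,t$ be indeterminates. **Multiline queues.** Let $L\ge 1$. A *ball system* is an $L\times n$ array (rows numbered $1,\dots,L$ from bottom to top, columns $1,\dots,n$ from left to right) in which each position is empty or holds a ball, such that the top row contains at least one ball and, for $1\le r<L$, row $r$ contains at least as many balls as row $r+1$. A *multiline queue* $Q$ consists of a ball system together with, for each $2\le r\le L$, an injective matching of all the balls of row $r$ to balls of row $r-1$. The balls get labels: a ball of row $r$ that is not the partner of a ball of row $r+1$ has label $r$, and the partner of a ball has the same label as that ball. Balls are matched in decreasing order of label, and it is required that if, when a ball $b$ is matched, the ball $b'$ directly underneath $b$ is still free (i.e. is not the partner of a ball of larger label), then $b$ is matched to $b'$; in this case $b,b'$ are *trivially paired*. The *type* of $Q$ is the sequence $\mu=(\mu_1,\dots,\mu_n)$ of labels in row $1$, with $0$ for an empty position. **Weights.** Let $m_c$ be the number of balls in column $c$, and $\mathrm{wt}_x(Q)=x_1^{m_1}\cdots x_n^{m_n}$. For each $2\le r\le L$, place the pairings between rows $r$ and $r-1$ in decreasing order of label; among the pairings of one label, first place the trivial ones, and then the nontrivial ones from right to left according to the position of the ball in row $r$.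 Let $p$ be a nontrivial pairing matching a ball of label $i$ in row $r$, column $c$, to a ball in row $r-1$, column $c'$. The balls of row $r-1$ that are not yet matched just before $p$ is placed are *free* for $p$ (this includes the ball in column $c'$), and the free balls in columns $c+1,c+2,\dots,c'-1$ (modulo $n$) are *skipped*. Put $$\mathrm{wt}_{qt}(p)=\frac{(1-t)\,t^{\#\mathrm{skipped}}}{1-q^{\,i-r+1}t^{\#\mathrm{free}}}\cdot\begin{cases}q^{\,i-r+1}&\text{if }c'<c,\\ 1&\text{if }c'>c.\end{cases}$$ Let $\mathrm{wt}_{qt}(Q)$ be the product of $\mathrm{wt}_{qt}(p)$ over all nontrivial pairings $p$ of $Q$, and $\mathrm{wt}(Q)=\mathrm{wt}_x(Q)\,\mathrm{wt}_{qt}(Q)$. For a composition $\mu=(\mu_1,\dots,\mu_n)$ with nonnegative integer parts and largest part $L$, define $$F_\mu=F_\mu(x_1,\dots,x_n;q,t)=\sum_Q\mathrm{wt}(Q)\in\mathbb{Q}(q,t)[x_1,\dots,x_n],$$ the sum being over all multiline queues of type $\mu$ with $L$ rows; for $\mu=(0,\dots,0)$ put $F_\mu=1$. **Operators.** For $1\le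 i\le n-1$ let $s_i$ act on polynomials by exchanging $x_i$ and $x_{i+1}$, and on compositions by exchanging $\mu_i$ and $\mu_{i+1}$. Let $$T_i=t-\frac{t x_i-x_{i+1}}{x_i-x_{i+1}}(1-s_i).$$ **Theorem.** For every composition $\mu=(\mu_1,\dots,\mu_n)$ of nonnegative integers: 1. $T_iF_\mu=F_{s_i\mu}$ for every $1\le i\le n-1$ with $\mu_i>\mu_{i+1}$; 2. $T_iF_\mu=t\,F_\mu$ for every $1\le i\le n-1$ with $\mu_i=\mu_{i+1}$; 3. $q^{\mu_n}F_\mu(x_1,\dots,x_n;q,t)=F_{(\mu_n,\mu_1,\dots,\mu_{n-1})}(q x_n,x_1,\dots,x_{n-1};q,t)$. Moreover, for every partition $\lambda=(\lambda_1\ge\dots\ge\lambda_n\ge0)$, the polynomials $F_\mu$, with $\mu$ running over the rearrangements of $\lambda$, form a *qKZ family*: they are homogeneous of degree $|\lambda|=\lambda_1+\dots+\lambda_n$ in $x_1,\dots,x_n$, with coefficients that are rational functions of $q$ and $t$, and they satisfy the relations 1–3. -/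

import Mathlib

/-- An `L × n` ball system.  Rows are numbered `1, …, L` from bottom to top, columns are elements
of `Fin n` from left to right; `ball r` is the set of columns occupied in row `r`.
(For `L = 0` there are no rows, and the requirement on the top row is void.) -/
structure BallSystem (L n : ℕ) where
  ball : ℕ → Finset (Fin n)
  ball_eq_empty : ∀ r, r = 0 ∨ L < r → ball r = ∅
  top_nonempty : 1 ≤ L → (ball L).Nonempty
  card_mono : ∀ r, 1 ≤ r → r < L → (ball (r + 1)).card ≤ (ball r).card

/-- A multiline queue with `L` rows and `n` columns.  `strand r c = some d` means that the ball in
row `r`, column `c` is matched to the ball in row `r - 1`, column `d`. The labels are those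
induced by the matching: `label r c` is the label of the ball in row `r`, column `c`, and `0`
marks an empty position. -/
structure MultilineQueue (L n : ℕ) extends BallSystem L n where
  strand : ℕ → Fin n → Option (Fin n)
  /-- exactly the balls in rows `2, …, L` are matched to a ball in the row below -/
  strand_isSome : ∀ r c, (strand r c).isSome = true ↔ 2 ≤ r ∧ c ∈ ball r
  strand_mem : ∀ r c d, strand (r + 1) c = some d → d ∈ ball r
  /-- different balls have different partners -/
  strand_inj : ∀ r c₁ c₂ d, strand r c₁ = some d → strand r c₂ = some d → c₁ = c₂
  label : ℕ → Fin n → ℕ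
  label_empty : ∀ r c, c ∉ ball r → label r c = 0
  /-- a ball in row `r` that is not a partner of a ball of row `r + 1` starts the label `r` -/
  label_new : ∀ r c, c ∈ ball r → (∀ b, strand (r + 1) b ≠ some c) → label r c = r
  /-- a partner inherits the label -/
  label_strand : ∀ r b c, strand (r + 1) b = some c → label r c = label (r + 1) b
  /-- Balls are matched in decreasing order of their labels: if the ball directly underneath is
  still free (it is not the partner of a ball of larger label), then it must be chosen. -/
  trivial_pairing : ∀ r c, 1 ≤ r → c ∈ ball (r + 1) → c ∈ ball r →
    (¬ ∃ b, strand (r + 1) b = some c ∧ label (r + 1) c < label (r + 1) b) →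
    strand (r + 1) c = some c

namespace MultilineQueue

variable {L n : ℕ}

/-- The labelling is determined by the balls and the matching. -/
theorem label_unique (Q Q' : MultilineQueue L n) (hb : Q.ball = Q'.ball)
    (hs : Q.strand = Q'.strand) : Q.label = Q'.label := by
  have key : ∀ k r, L < r + k → ∀ c, Q.label r c = Q'.label r c := by
    intro k
    induction k with
    | zero =>
      intro r hr c
      have h1 := Q.ball_eq_empty r (Or.inr (by omega))
      have h2 := Q'.ball_eq_empty r (Or.inr (by omega))
      rw [Q.label_empty r c (by simp [h1]), Q'.label_empty r c (by simp [h2])]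
    | succ k ih =>
      intro r hr c
      by_cases hc : c ∈ Q.ball r
      · by_cases hm : ∃ b, Q.strand (r + 1) b = some c
        · obtain ⟨b, hbc⟩ := hm
          rw [Q.label_strand r b c hbc, Q'.label_strand r b c (hs ▸ hbc)]
          exact ih (r + 1) (by omega) b
        · push Not at hm
          rw [Q.label_new r c hc hm, Q'.label_new r c (hb ▸ hc) (hs ▸ hm)]
      · rw [Q.label_empty r c hc, Q'.label_empty r c (hb ▸ hc)]
  funext r c
  exact key (L + 1) r (by omega) c

/-- There are finitely many multiline queues of a given size. -/
noncomputable instance : Fintype (MultilineQueue L n) :=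
  Fintype.ofInjective
    (fun Q => (fun r => (Q.ball r, Q.strand r) :
      Fin (L + 1) → Finset (Fin n) × (Fin n → Option (Fin n)))) <| by
    intro Q Q' h
    have h' : ∀ r, r ≤ L → Q.ball r = Q'.ball r ∧ Q.strand r = Q'.strand r := by
      intro r hr
      have := congrFun h ⟨r, Nat.lt_succ_of_le hr⟩
      simpa using this
    have hb : Q.ball = Q'.ball := by
      funext r
      by_cases hr : r ≤ L
      · exact (h' r hr).1
      · rw [Q.ball_eq_empty r (Or.inr (by omega)), Q'.ball_eq_empty r (Or.inr (by omega))]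
    have hs : Q.strand = Q'.strand := by
      funext r c
      by_cases hr : r ≤ L
      · rw [(h' r hr).2]
      · have e1 : Q.strand r c = none := by
          rw [← Option.not_isSome_iff_eq_none, Q.strand_isSome,
            Q.ball_eq_empty r (Or.inr (by omega))]
          simp
        have e2 : Q'.strand r c = none := by
          rw [← Option.not_isSome_iff_eq_none, Q'.strand_isSome,
            Q'.ball_eq_empty r (Or.inr (by omega))]
          simp
        rw [e1, e2]
    have hl := label_unique Q Q' hb hs
    obtain ⟨⟨b, _, _, _⟩, s, _, _, _, l, _, _, _, _⟩ := Q
    obtain ⟨⟨b', _, _, _⟩, s', _, _, _, l', _, _, _, _⟩ := Q'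
    simp only at hb hs hl
    subst hb hs hl
    rfl

variable (Q : MultilineQueue L n)

/-- The strand of the ball in row `r`, column `b` has been placed when we come to the nontrivial
pairing of the ball in row `r`, column `c`: labels are read in decreasing order; within a label
the trivial pairings are placed first, and then the balls are read from right to left. -/
def PlacedBefore (r : ℕ) (b c : Fin n) : Prop :=
  Q.label r c < Q.label r b ∨
    (Q.label r b = Q.label r c ∧ (Q.strand r b = some b ∨ c < b))

instance (r : ℕ) (b c : Fin n) : Decidable (Q.PlacedBefore r b c) := by
  unfold PlacedBefore; infer_instance

/-- The balls of row `r - 1` that are free when we come to the ball in row `r`, column `c`: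
the balls not yet matched (the future partner is one of them). -/
def freeBalls (r : ℕ) (c : Fin n) : Finset (Fin n) :=
  {d ∈ Q.ball (r - 1) | ∀ b, Q.strand r b = some d → ¬ Q.PlacedBefore r b c}

/-- The free balls in the columns `c + 1, …, d - 1` (modulo `n`). Subtraction in `Fin n` is
modulo `n`. -/
def skippedBalls (r : ℕ) (c d : Fin n) : Finset (Fin n) :=
  {e ∈ Q.freeBalls r c | 0 < (e - c).val ∧ (e - c).val < (d - c).val}

/-- The nontrivial pairings between rows `r` and `r - 1`, as pairs of columns. -/
def nontrivialPairings (r : ℕ) : Finset (Fin n × Fin n) :=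
  {p | Q.strand r p.1 = some p.2 ∧ p.2 ≠ p.1}

/-- The `qt`-weight of the nontrivial pairing of the ball in row `r`, column `c` with the ball in
row `r - 1`, column `d`. -/
def pairingWt {K : Type*} [Field K] (q t : K) (r : ℕ) (c d : Fin n) : K :=
  (1 - t) * t ^ (Q.skippedBalls r c d).card /
      (1 - q ^ (Q.label r c - r + 1) * t ^ (Q.freeBalls r c).card) *
    (if d < c then q ^ (Q.label r c - r + 1) else 1)

/-- The `qt`-weight of a multiline queue. -/
def wtqt {K : Type*} [Field K] (q t : K) : K :=
  ∏ r ∈ Finset.Icc 2 L, ∏ p ∈ Q.nontrivialPairings r, Q.pairingWt q t r p.1 p.2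

/-- The number of balls in column `c`. -/
def colCount (c : Fin n) : ℕ := (Finset.filter (fun r => c ∈ Q.ball r) (Finset.Icc 1 L)).card

/-- The `x`-weight of a multiline queue. -/
noncomputable def wtx (K : Type*) [Field K] : MvPolynomial (Fin n) K :=
  ∏ c, MvPolynomial.X c ^ Q.colCount c

/-- The weight of a multiline queue. -/
noncomputable def wt {K : Type*} [Field K] (q t : K) : MvPolynomial (Fin n) K :=
  Q.wtx K * MvPolynomial.C (Q.wtqt q t)

/-- `Q` has type `μ`: the labelling of the bottom row is `μ`. -/
def HasType (μ : Fin n → ℕ) : Prop := ∀ c, Q.label 1 c = μ c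

instance (μ : Fin n → ℕ) : Decidable (Q.HasType μ) := by
  unfold HasType; infer_instance

end MultilineQueue

/-- The polynomial `F_μ`: the sum of the weights of all multiline queues of type `μ` with `L` rows,
where `L` is the largest part of `μ`. -/
noncomputable def mlqPoly {K : Type*} [Field K] (q t : K) {n : ℕ} (μ : Fin n → ℕ) :
    MvPolynomial (Fin n) K :=
  ∑ Q : MultilineQueue (Finset.univ.sup μ) n with Q.HasType μ, Q.wt q t

section Operators

variable {K : Type*} [Field K] {n : ℕ} [NeZero n]

/-- The action of `s_i` on polynomials, exchanging the variables `x_i` and `x_{i+1}`. -/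
noncomputable def swapVars (i : Fin n) (f : MvPolynomial (Fin n) K) : MvPolynomial (Fin n) K :=
  MvPolynomial.rename (Equiv.swap i (i + 1)) f

/-- The action of `s_i` on compositions, exchanging the parts `μ_i` and `μ_{i+1}`. -/
def swapParts (i : Fin n) (μ : Fin n → ℕ) : Fin n → ℕ := μ ∘ Equiv.swap i (i + 1)

/-- The Hecke operator `T_i = t - (t x_i - x_{i+1}) / (x_i - x_{i+1}) (1 - s_i)`, with values in
the field of rational functions in the variables. It is used only for `i` not the last index. -/
noncomputable def heckeT (t : K) (i : Fin n) (f : MvPolynomial (Fin n) K) :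
    FractionRing (MvPolynomial (Fin n) K) :=
  let ι := algebraMap (MvPolynomial (Fin n) K) (FractionRing (MvPolynomial (Fin n) K))
  let x : Fin n → MvPolynomial (Fin n) K := MvPolynomial.X
  ι (MvPolynomial.C t * f) -
    ι (MvPolynomial.C t * x i - x (i + 1)) / ι (x i - x (i + 1)) * ι (f - swapVars i f)

/-- `(μ_1, …, μ_n) ↦ (μ_n, μ_1, …, μ_{n-1})`. -/
def rotateParts (μ : Fin n → ℕ) : Fin n → ℕ := fun j => μ (j - 1)

/-- `f(x_1, …, x_n) ↦ f(q x_n, x_1, …, x_{n-1})`. -/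
noncomputable def shiftVars (q : K) (f : MvPolynomial (Fin n) K) : MvPolynomial (Fin n) K :=
  MvPolynomial.aeval (fun j : Fin n =>
    if j = 0 then MvPolynomial.C q * MvPolynomial.X (j - 1)
    else (MvPolynomial.X (j - 1) : MvPolynomial (Fin n) K)) f

/-- `f` is a qKZ family for `lam`: the polynomials `f μ`, for the rearrangements `μ = lam ∘ σ`, are
homogeneous of degree `|lam|` and satisfy the exchange relations and the cyclic relation. -/
structure IsQKZFamily (q t : K) (lam : Fin n → ℕ)
    (f : (Fin n → ℕ) → MvPolynomial (Fin n) K) : Prop where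
  homogeneous : ∀ σ : Equiv.Perm (Fin n), (f (lam ∘ σ)).IsHomogeneous (∑ i, lam i)
  exchange : ∀ (σ : Equiv.Perm (Fin n)) (μ : Fin n → ℕ), μ = lam ∘ σ →
    ∀ i : Fin n, (i : ℕ) + 1 < n → μ (i + 1) < μ i →
      heckeT t i (f μ) = algebraMap _ _ (f (swapParts i μ))
  exchange_eq : ∀ (σ : Equiv.Perm (Fin n)) (μ : Fin n → ℕ), μ = lam ∘ σ →
    ∀ i : Fin n, (i : ℕ) + 1 < n → μ i = μ (i + 1) →
      heckeT t i (f μ) = algebraMap _ _ (MvPolynomial.C t * f μ)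
  cyclic : ∀ (σ : Equiv.Perm (Fin n)) (μ : Fin n → ℕ), μ = lam ∘ σ →
    MvPolynomial.C (q ^ μ (0 - 1)) * f μ = shiftVars q (f (rotateParts μ))

end Operators

/-- The field `ℚ(q, t)` of rational functions in two indeterminates. -/
abbrev QTField : Type := FractionRing (MvPolynomial (Fin 2) ℚ)

/-- The indeterminate `q`. -/
noncomputable def qVar : QTField := algebraMap (MvPolynomial (Fin 2) ℚ) _ (MvPolynomial.X 0)

/-- The indeterminate `t`. -/
noncomputable def tVar : QTField := algebraMap (MvPolynomial (Fin 2) ℚ) _ (MvPolynomial.X 1)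

/-! Deleting the bottom row of a multiline queue of type μ and lowering all labels by one leaves a
multiline queue of some type ν with one row fewer. Hence F_μ = (∏_{μ_c ≠ 0} x_c) · Σ_ν R(μ, ν) F_ν
(`rowsPoly_succ`), where R = `rowCoeff` sums the weights of the possible pairings between rows 2 and
1. All relations follow by induction on the number of rows from relations for R. In the induction
the number of rows is a parameter of its own and not tied to the largest part of μ.

R(μ, ν) is a product over the labels (`sum_rowWt`). The factor of a label depends on three sets of
columns: the upper balls A with this label, the lower balls B free for them, the partners C ⊆ B. The
key fact is that the total weight of the matchings does not depend on the order in which the balls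
are placed (`fillSum_perm`); it reduces to an identity for two balls (`arcWt_exchange`). So any ball
may be placed first, and the effect of exchanging the adjacent columns i and j = i + 1 can be
computed. Usually the exchange preserves all relevant orders and changes nothing (`levelWt_swap`).
The exceptions are an upper ball next to a free lower ball that is not a partner (a factor t), a
partner next to a free ball that is not one (a factor t), and an upper ball next to a partner (two
terms, with t and 1 - t). Going through the relative sizes of μ_i, μ_j, ν_i, ν_j gives the lemmas
`rowCoeff_swap_*`.

On the Hecke side, T² = (t - 1)T + t turns the induction hypothesis into a formula for T F_ν for
every ν (`heckeImage`), and T x_i = x_j (T + 1 - t) moves T past the monomial. The exchange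
relations then follow by collecting the terms of ν and s_i ν.

For the cyclic relation, rotating the columns preserves the numbers of free and skipped balls, and
only the powers of q marking the arcs that wrap around change (`arcWt_rotate`). Homogeneity holds
because R(μ, ν) ≠ 0 forces equally many upper and lower balls of each label at least 2. -/

/-! ### Matchings of one label: independence of the order of placement. -/

section Filling

variable {K : Type*} [Field K] {n : ℕ}

/-- The weight of a nontrivial pairing from column `c` to column `d` when `B` is the set of free
balls. -/
def arcWt (z t : K) (B : Finset (Fin n)) (c d : Fin n) : K :=
  (1 - t) * t ^ ({e ∈ B | 0 < (e - c).val ∧ (e - c).val < (d - c).val} : Finset (Fin n)).card /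
      (1 - z * t ^ B.card) * (if d < c then z else 1)

/-- The weighted sum over all ways to match the balls in the columns listed in `l`, in the order
of the list, with all the balls of `C`, when `B` is the set of free balls at the beginning. -/
def fillSum (z t : K) : List (Fin n) → Finset (Fin n) → Finset (Fin n) → K
  | [], _, C => if C = ∅ then 1 else 0
  | c :: l, B, C => ∑ d ∈ C, arcWt z t B c d * fillSum z t l (B.erase d) (C.erase d)

/-- The number of elements of `B` to the left of `x`. -/
def leftCount (B : Finset (Fin n)) (x : Fin n) : ℕ := ({e ∈ B | e < x} : Finset (Fin n)).card

/-- An arc going right passes the balls strictly between `c` and `d`; an arc that wraps around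
passes all balls except those in `[d, c)`. The additive form avoids subtraction of natural numbers.
-/
theorem card_skipped (B : Finset (Fin n)) {c d : Fin n} (hc : c ∉ B) (hd : d ∈ B) :
    ({e ∈ B | 0 < (e - c).val ∧ (e - c).val < (d - c).val} : Finset (Fin n)).card + leftCount B c =
      leftCount B d + if d < c then B.card else 0 := by
  have hne : d ≠ c := fun h => hc (h ▸ hd)
  have hsub : ∀ x y : Fin n, (x - y).val = if y ≤ x then x.val - y.val else n + x.val - y.val := by
    intro x y
    split_ifs with h
    · exact Fin.sub_val_of_le h
    · rw [Fin.coe_sub_iff_lt.2 (not_le.1 h)]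
  unfold leftCount
  split_ifs with h
  · have hun : ({e ∈ B | e < c} : Finset (Fin n)) =
        {e ∈ B | e < d} ∪ {e ∈ B | d ≤ e ∧ e < c} := by
      ext e; simp only [Finset.mem_filter, Finset.mem_union]
      constructor
      · rintro ⟨h1, h2⟩
        by_cases h3 : e < d
        · exact Or.inl ⟨h1, h3⟩
        · exact Or.inr ⟨h1, not_lt.1 h3, h2⟩
      · rintro (⟨h1, h2⟩ | ⟨h1, h2, h3⟩)
        · exact ⟨h1, h2.trans h⟩
        · exact ⟨h1, h3⟩
    rw [hun, Finset.card_union_of_disjoint]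
    · clear hun
      suffices hs : ({e ∈ B | 0 < (e - c).val ∧ (e - c).val < (d - c).val} : Finset (Fin n)).card +
          ({e ∈ B | d ≤ e ∧ e < c} : Finset (Fin n)).card = B.card by omega
      rw [← Finset.card_union_of_disjoint]
      · congr 1
        ext e
        simp only [Finset.mem_filter, Finset.mem_union]
        have key : e ∈ B → e ≠ c := fun h h' => hc (h' ▸ h)
        have := hsub e c
        have h2 := hsub d c
        rw [if_neg (not_le.2 h)] at h2
        by_cases he : e ∈ B
        · have := key he
          simp only [he, true_and, iff_true]
          simp only [Fin.le_def, Fin.lt_def, ne_eq, Fin.ext_iff] at *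
          have := e.2; have := c.2
          split_ifs at * <;> omega
        · simp [he]
      · rw [Finset.disjoint_left]
        intro e h1 h3
        simp only [Finset.mem_filter] at h1 h3
        have h4 := hsub e c
        have h2 := hsub d c
        rw [if_neg (not_le.2 h)] at h2
        rw [if_neg (not_le.2 h3.2.2)] at h4
        simp only [Fin.le_def, Fin.lt_def] at *
        have := e.2; have := c.2
        omega
    · rw [Finset.disjoint_left]
      intro e h1 h3
      simp only [Finset.mem_filter] at h1 h3
      exact absurd h1.2 (not_lt.2 h3.2.1)
  · have hlt : c < d := lt_of_le_of_ne (not_lt.1 h) (Ne.symm hne)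
    rw [add_zero, ← Finset.card_union_of_disjoint]
    · congr 1
      ext e
      simp only [Finset.mem_filter, Finset.mem_union]
      by_cases he : e ∈ B
      · have : e ≠ c := fun h' => hc (h' ▸ he)
        simp only [he, true_and]
        have h3 := hsub e c
        have h2 := hsub d c
        rw [if_pos hlt.le] at h2
        simp only [Fin.le_def, Fin.lt_def, ne_eq, Fin.ext_iff] at *
        have := e.2; have := c.2; have := d.2
        split_ifs at * <;> omega
      · simp [he]
    · rw [Finset.disjoint_left]
      intro e h1 h3
      simp only [Finset.mem_filter] at h1 h3
      have h4 := hsub e c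
      have h2 := hsub d c
      rw [if_pos hlt.le] at h2
      rw [if_neg (not_le.2 h3.2)] at h4
      simp only [Fin.le_def, Fin.lt_def] at *
      have := e.2; have := c.2; have := d.2
      omega

/-- In this form `c` and `d` contribute separate factors, apart from the test `d < c`. All later
identities between arc weights that depend on the linear order are computed from it. -/
theorem arcWt_eq {t : K} (ht : t ≠ 0) (z : K) {B : Finset (Fin n)} {c d : Fin n}
    (hc : c ∉ B) (hd : d ∈ B) :
    arcWt z t B c d = (1 - t) / (1 - z * t ^ B.card) *
      (t ^ leftCount B d / t ^ leftCount B c * if d < c then z * t ^ B.card else 1) := by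
  have h := card_skipped B hc hd
  have h2 : t ^ ({e ∈ B | 0 < (e - c).val ∧ (e - c).val < (d - c).val} : Finset (Fin n)).card =
      t ^ leftCount B d / t ^ leftCount B c * (if d < c then t ^ B.card else 1) := by
    rw [div_mul_eq_mul_div, eq_div_iff (pow_ne_zero _ ht), ← pow_add, h, pow_add]
    split_ifs <;> simp
  rw [arcWt, h2]
  split_ifs <;> ring

theorem leftCount_erase (B : Finset (Fin n)) {d : Fin n} (hd : d ∈ B) (x : Fin n) :
    leftCount B x = leftCount (B.erase d) x + if d < x then 1 else 0 := by
  unfold leftCount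
  rw [Finset.filter_erase]
  split_ifs with h
  · rw [Finset.card_erase_add_one (by simp [hd, h])]
  · rw [Finset.erase_eq_of_notMem (by simp [h]), add_zero]

/-- Removing a free ball `d` divides `t ^ leftCount B x` by `t` exactly when `d < x`. All eight
weights thus become rational expressions in the same few quantities, and the identity is checked for
each position of `c₁` and `c₂` relative to `d₁ < d₂`. -/
theorem arcWt_exchange_of_lt {t : K} (ht : t ≠ 0) (z : K) {B : Finset (Fin n)} {c₁ c₂ d₁ d₂ : Fin n}
    (h₁ : c₁ ∉ B) (h₂ : c₂ ∉ B) (hd₁ : d₁ ∈ B) (hd₂ : d₂ ∈ B) (hd : d₁ < d₂) :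
    arcWt z t B c₁ d₁ * arcWt z t (B.erase d₁) c₂ d₂ +
      arcWt z t B c₁ d₂ * arcWt z t (B.erase d₂) c₂ d₁ =
    arcWt z t B c₂ d₁ * arcWt z t (B.erase d₁) c₁ d₂ +
      arcWt z t B c₂ d₂ * arcWt z t (B.erase d₂) c₁ d₁ := by
  have a1 : d₁ ∈ B.erase d₂ := by simp [hd₁, hd.ne]
  have a2 : d₂ ∈ B.erase d₁ := by simp [hd₂, hd.ne']
  have nc : ∀ {c d}, c ∉ B → c ∉ B.erase d := fun h h' => h (Finset.mem_of_mem_erase h')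
  have k1 : (B.erase d₁).card = B.card - 1 := Finset.card_erase_of_mem hd₁
  have k2 : (B.erase d₂).card = B.card - 1 := Finset.card_erase_of_mem hd₂
  have hB : B.card = (B.card - 1) + 1 := by
    have := Finset.card_pos.2 ⟨d₁, hd₁⟩; omega
  rw [arcWt_eq ht z h₁ hd₁, arcWt_eq ht z h₁ hd₂, arcWt_eq ht z h₂ hd₁, arcWt_eq ht z h₂ hd₂,
    arcWt_eq ht z (nc h₁) a1, arcWt_eq ht z (nc h₁) a2, arcWt_eq ht z (nc h₂) a1,
    arcWt_eq ht z (nc h₂) a2, k1, k2]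
  have l11 := leftCount_erase B hd₁ c₁
  have l12 := leftCount_erase B hd₁ c₂
  have l21 := leftCount_erase B hd₂ c₁
  have l22 := leftCount_erase B hd₂ c₂
  have m1 := leftCount_erase B hd₁ d₂
  have m2 := leftCount_erase B hd₂ d₁
  rw [if_pos hd] at m1
  rw [if_neg hd.not_gt] at m2
  have hZ : t ^ B.card = t ^ (B.card - 1) * t := by rw [← pow_succ, ← hB]
  have g1 := pow_ne_zero (leftCount (B.erase d₁) c₁) ht
  have g2 := pow_ne_zero (leftCount (B.erase d₁) c₂) ht
  have g3 := pow_ne_zero (leftCount (B.erase d₂) c₁) ht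
  have g4 := pow_ne_zero (leftCount (B.erase d₂) c₂) ht
  have e11 : t ^ leftCount (B.erase d₁) c₁ = t ^ leftCount B c₁ / if d₁ < c₁ then t else 1 := by
    rw [l11]; split_ifs <;> simp [pow_succ, ht]
  have e12 : t ^ leftCount (B.erase d₁) c₂ = t ^ leftCount B c₂ / if d₁ < c₂ then t else 1 := by
    rw [l12]; split_ifs <;> simp [pow_succ, ht]
  have e21 : t ^ leftCount (B.erase d₂) c₁ = t ^ leftCount B c₁ / if d₂ < c₁ then t else 1 := by
    rw [l21]; split_ifs <;> simp [pow_succ, ht]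
  have e22 : t ^ leftCount (B.erase d₂) c₂ = t ^ leftCount B c₂ / if d₂ < c₂ then t else 1 := by
    rw [l22]; split_ifs <;> simp [pow_succ, ht]
  have n1 : t ^ leftCount (B.erase d₁) d₂ = t ^ leftCount B d₂ / t := by
    rw [m1]; simp [pow_succ, ht]
  have n2 : t ^ leftCount (B.erase d₂) d₁ = t ^ leftCount B d₁ := by rw [m2]; simp
  rw [e11, e12, e21, e22, n1, n2, hZ]
  have q1 := pow_ne_zero (leftCount B c₁) ht
  have q2 := pow_ne_zero (leftCount B c₂) ht
  generalize t ^ leftCount B c₁ = u1 at *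
  generalize t ^ leftCount B c₂ = u2 at *
  generalize t ^ leftCount B d₁ = v1 at *
  generalize t ^ leftCount B d₂ = v2 at *
  generalize t ^ (B.card - 1) = w at *
  generalize (1 - t) / (1 - z * (w * t)) = y1
  generalize (1 - t) / (1 - z * w) = y2
  -- This excludes the impossible ones among the sixteen cases.
  have key : ∀ c : Fin n, d₂ < c → d₁ < c := fun c h => hd.trans h
  by_cases p1 : d₁ < c₁ <;> by_cases p2 : d₁ < c₂ <;> by_cases p3 : d₂ < c₁ <;>
    by_cases p4 : d₂ < c₂ <;>
    first
    | exact absurd (key _ p3) p1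
    | exact absurd (key _ p4) p2
    | (simp only [p1, p2, p3, p4, if_true, if_false]; field_simp; try ring)

theorem arcWt_exchange {t : K} (ht : t ≠ 0) (z : K) {B : Finset (Fin n)} {c₁ c₂ d₁ d₂ : Fin n}
    (h₁ : c₁ ∉ B) (h₂ : c₂ ∉ B) (hd₁ : d₁ ∈ B) (hd₂ : d₂ ∈ B) (hd : d₁ ≠ d₂) :
    arcWt z t B c₁ d₁ * arcWt z t (B.erase d₁) c₂ d₂ +
      arcWt z t B c₁ d₂ * arcWt z t (B.erase d₂) c₂ d₁ =
    arcWt z t B c₂ d₁ * arcWt z t (B.erase d₁) c₁ d₂ +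
      arcWt z t B c₂ d₂ * arcWt z t (B.erase d₂) c₁ d₁ := by
  rcases lt_or_gt_of_ne hd with h | h
  · exact arcWt_exchange_of_lt ht z h₁ h₂ hd₁ hd₂ h
  · have := arcWt_exchange_of_lt ht z h₁ h₂ hd₂ hd₁ h
    linear_combination this

/-- In the difference of the two sides the terms for the partners `(d₁, d₂)` and `(d₂, d₁)` cancel
by `arcWt_exchange`, since both leave the same sets to the balls of `l`. -/
theorem fillSum_swap {t : K} (ht : t ≠ 0) (z : K) {c₁ c₂ : Fin n} (l : List (Fin n))
    {B C : Finset (Fin n)} (h₁ : c₁ ∉ B) (h₂ : c₂ ∉ B) (hC : C ⊆ B) :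
    fillSum z t (c₁ :: c₂ :: l) B C = fillSum z t (c₂ :: c₁ :: l) B C := by
  simp only [fillSum, Finset.mul_sum]
  rw [← sub_eq_zero, ← Finset.sum_sub_distrib]
  simp only [← Finset.sum_sub_distrib]
  rw [Finset.sum_sigma']
  refine Finset.sum_involution (fun x _ => ⟨x.2, x.1⟩) ?_ ?_ ?_ ?_
  · rintro ⟨d₁, d₂⟩ h
    simp only [Finset.mem_sigma, Finset.mem_erase] at h
    have := arcWt_exchange ht z h₁ h₂ (hC h.1) (hC h.2.2) (Ne.symm h.2.1)
    rw [Finset.erase_right_comm (s := B), Finset.erase_right_comm (s := C)]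
    linear_combination (fillSum z t l ((B.erase d₂).erase d₁) ((C.erase d₂).erase d₁)) * this
  · rintro ⟨d₁, d₂⟩ h _ h'
    simp only [Finset.mem_sigma, Finset.mem_erase] at h
    simp only [Sigma.mk.injEq] at h'
    exact h.2.1 h'.1
  · rintro ⟨d₁, d₂⟩ h
    simp only [Finset.mem_sigma, Finset.mem_erase] at h ⊢
    exact ⟨h.2.2, Ne.symm h.2.1, h.1⟩
  · rintro ⟨d₁, d₂⟩ h
    rfl

/-- The balls can be matched in any order. -/
theorem fillSum_perm {t : K} (ht : t ≠ 0) (z : K) {l l' : List (Fin n)} (h : l.Perm l') :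
    ∀ {B C : Finset (Fin n)}, (∀ c ∈ l, c ∉ B) → C ⊆ B →
      fillSum z t l B C = fillSum z t l' B C := by
  induction h with
  | nil => intros; rfl
  | cons c _ ih =>
    intro B C hl hC
    simp only [fillSum]
    refine Finset.sum_congr rfl fun d _ => ?_
    rw [ih (fun x hx h' => hl x (List.mem_cons_of_mem _ hx) (Finset.mem_of_mem_erase h'))
      (Finset.erase_subset_erase _ hC)]
  | swap c₁ c₂ l =>
    intro B C hl hC
    exact fillSum_swap ht z l (hl _ (by simp)) (hl _ (by simp)) hC
  | trans h₁ _ ih₁ ih₂ =>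
    intro B C hl hC
    rw [ih₁ hl hC, ih₂ (fun c hc => hl c (h₁.mem_iff.2 hc)) hC]

theorem fillSum_eq_zero_of_card (z t : K) : ∀ (l : List (Fin n)) (B C : Finset (Fin n)),
    l.length ≠ C.card → fillSum z t l B C = 0
  | [], B, C, h => by
    rw [fillSum, if_neg]
    rintro rfl
    simp at h
  | c :: l, B, C, h => by
    rw [fillSum]
    refine Finset.sum_eq_zero fun d hd => ?_
    rw [fillSum_eq_zero_of_card z t l, mul_zero]
    rw [Finset.card_erase_of_mem hd]
    have := Finset.card_pos.2 ⟨d, hd⟩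
    simp only [List.length_cons] at h
    omega

end Filling

/-! ### Order-preserving relabelling of columns. -/

section Relabelling

variable {K : Type*} [Field K] {n : ℕ}

theorem leftCount_map (φ : Equiv.Perm (Fin n)) (B : Finset (Fin n)) (x : Fin n)
    (h : ∀ e ∈ B, φ e < φ x ↔ e < x) :
    leftCount (B.map φ.toEmbedding) (φ x) = leftCount B x := by
  unfold leftCount
  rw [Finset.filter_map, Finset.card_map]
  congr 1
  exact Finset.filter_congr fun e he => by simpa using h e he

/-- By `arcWt_eq` the weight sees only the relative order of `c` and the free balls; empty columns
in between are irrelevant. -/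
theorem arcWt_map {t : K} (ht : t ≠ 0) (z : K) (φ : Equiv.Perm (Fin n)) {B : Finset (Fin n)}
    {c d : Fin n} (hc : c ∉ B) (hd : d ∈ B)
    (h : StrictMonoOn φ (insert c (B : Set (Fin n)))) :
    arcWt z t (B.map φ.toEmbedding) (φ c) (φ d) = arcWt z t B c d := by
  have hB : ∀ e ∈ B, e ∈ insert c (B : Set (Fin n)) := fun e he => by simp [he]
  rw [arcWt_eq ht z (by simpa using hc) (by simpa using hd), arcWt_eq ht z hc hd,
    leftCount_map φ B c fun e he => h.lt_iff_lt (hB e he) (by simp),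
    leftCount_map φ B d fun e he => h.lt_iff_lt (hB e he) (hB d hd), Finset.card_map]
  simp only [h.lt_iff_lt (hB d hd) (Set.mem_insert c _)]

theorem fillSum_map {t : K} (ht : t ≠ 0) (z : K) (φ : Equiv.Perm (Fin n)) :
    ∀ (l : List (Fin n)) {B C : Finset (Fin n)}, (∀ c ∈ l, c ∉ B) → C ⊆ B →
      (∀ c ∈ l, StrictMonoOn φ (insert c (B : Set (Fin n)))) →
      fillSum z t (l.map φ) (B.map φ.toEmbedding) (C.map φ.toEmbedding) = fillSum z t l B C
  | [], B, C, _, _, _ => by simp [fillSum]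
  | c :: l, B, C, hl, hC, h => by
    simp only [List.map_cons, fillSum, Finset.sum_map]
    refine Finset.sum_congr rfl fun d hd => ?_
    rw [← Finset.map_erase, ← Finset.map_erase, fillSum_map ht z φ l]
    · congr 1
      exact arcWt_map ht z φ (hl c (by simp)) (hC hd) (h c (by simp))
    · exact fun x hx h' => hl x (List.mem_cons_of_mem _ hx) (Finset.mem_of_mem_erase h')
    · exact Finset.erase_subset_erase _ hC
    · intro x hx
      refine (h x (List.mem_cons_of_mem _ hx)).mono (Set.insert_subset_insert ?_)
      simp

/-- The weights of the matchings of the balls in the columns `A`. -/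
noncomputable def matchSum (z t : K) (A B C : Finset (Fin n)) : K := fillSum z t A.toList B C

theorem matchSum_insert {t : K} (ht : t ≠ 0) (z : K) {c : Fin n} {A B C : Finset (Fin n)}
    (hcA : c ∉ A) (hcB : c ∉ B) (hAB : Disjoint A B) (hC : C ⊆ B) :
    matchSum z t (insert c A) B C =
      ∑ d ∈ C, arcWt z t B c d * matchSum z t A (B.erase d) (C.erase d) := by
  have := fillSum_perm ht z (Finset.toList_insert hcA) (B := B) (C := C) (fun x hx => by
    simp only [Finset.mem_toList, Finset.mem_insert] at hx
    rcases hx with rfl | hx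
    · exact hcB
    · exact Finset.disjoint_left.1 hAB hx) hC
  exact this

theorem matchSum_map {t : K} (ht : t ≠ 0) (z : K) (φ : Equiv.Perm (Fin n)) {A B C : Finset (Fin n)}
    (hAB : Disjoint A B) (hC : C ⊆ B) (h : ∀ c ∈ A, StrictMonoOn φ (insert c (B : Set (Fin n)))) :
    matchSum z t (A.map φ.toEmbedding) (B.map φ.toEmbedding) (C.map φ.toEmbedding) =
      matchSum z t A B C := by
  unfold matchSum
  rw [← fillSum_map ht z φ A.toList (fun c hc => Finset.disjoint_left.1 hAB (by simpa using hc)) hC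
    fun c hc => h c (by simpa using hc)]
  -- The list of the image and the image of the list may be ordered differently, which is harmless.
  refine fillSum_perm ht z ?_ ?_ ?_
  · refine (List.perm_ext_iff_of_nodup (Finset.nodup_toList _)
      ((Finset.nodup_toList _).map φ.injective)).2 fun a => ?_
    simp only [Finset.mem_toList, Finset.mem_map_equiv, List.mem_map]
    exact ⟨fun h => ⟨_, h, by simp⟩, fun ⟨x, hx, e⟩ => by simpa [← e] using hx⟩
  · intro c hc
    simp only [Finset.mem_toList, Finset.mem_map_equiv] at hc ⊢
    exact Finset.disjoint_left.1 hAB hc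
  · exact Finset.map_subset_map.2 hC

end Relabelling

/-! ### Exchange of two adjacent columns within one label. -/

section AdjacentSwap

variable {K : Type*} [Field K] {n : ℕ} {i j : Fin n}

theorem swap_lt_swap (hij : (j : ℕ) = i + 1) {x y : Fin n} (hxy : ¬ (x = i ∧ y = j)) (h : x < y) :
    Equiv.swap i j x < Equiv.swap i j y := by
  simp only [Equiv.swap_apply_def, Fin.lt_def, Fin.ext_iff] at *
  split_ifs <;> omega

theorem strictMonoOn_swap (hij : (j : ℕ) = i + 1) {S : Set (Fin n)} (h : ¬ (i ∈ S ∧ j ∈ S)) :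
    StrictMonoOn (Equiv.swap i j) S := fun _ hx _ hy hxy =>
  swap_lt_swap hij (fun hh => h ⟨hh.1 ▸ hx, hh.2 ▸ hy⟩) hxy

/-- The image of a set of columns under the exchange of two columns. -/
abbrev swapSet (i j : Fin n) (S : Finset (Fin n)) : Finset (Fin n) :=
  S.map (Equiv.swap i j).toEmbedding

theorem mem_swapSet {S : Finset (Fin n)} {x : Fin n} :
    x ∈ swapSet i j S ↔ Equiv.swap i j x ∈ S := by
  simp [swapSet]

theorem swapSet_eq_self {S : Finset (Fin n)} (h : i ∈ S ↔ j ∈ S) : swapSet i j S = S := by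
  ext x
  rw [mem_swapSet, Equiv.swap_apply_def]
  split_ifs with h1 h2
  · rw [h1, h]
  · rw [h2, h]
  · rfl

theorem leftCount_swapSet (hij : (j : ℕ) = i + 1) (B : Finset (Fin n)) {x : Fin n} (hx : x ≠ j) :
    leftCount (swapSet i j B) x = leftCount B x := by
  unfold leftCount
  rw [Finset.filter_map, Finset.card_map]
  congr 1
  refine Finset.filter_congr fun e _ => ?_
  simp only [Function.comp_apply, Equiv.coe_toEmbedding, Equiv.swap_apply_def, Fin.lt_def, ne_eq,
    Fin.ext_iff] at *
  split_ifs <;> omega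

theorem leftCount_succ (hij : (j : ℕ) = i + 1) (B : Finset (Fin n)) :
    leftCount B j = leftCount B i + if i ∈ B then 1 else 0 := by
  unfold leftCount
  split_ifs with h
  · rw [← Finset.card_insert_of_notMem (a := i) (by simp)]
    congr 1
    ext e
    simp only [Finset.mem_filter, Finset.mem_insert, Fin.lt_def]
    constructor
    · rintro ⟨h1, h2⟩
      by_cases h3 : e = i
      · exact Or.inl h3
      · right; refine ⟨h1, ?_⟩
        rw [Fin.ext_iff] at h3; omega
    · rintro (rfl | ⟨h1, h2⟩)
      · exact ⟨h, by omega⟩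
      · exact ⟨h1, by omega⟩
  · rw [add_zero]
    congr 1
    refine Finset.filter_congr fun e he => ?_
    have : e ≠ i := fun h' => h (h' ▸ he)
    rw [ne_eq, Fin.ext_iff] at this
    simp only [Fin.lt_def]
    omega

/-- Starting one column further to the right avoids skipping the ball there. -/
theorem arcWt_swapSet {t : K} (ht : t ≠ 0) (z : K) (hij : (j : ℕ) = i + 1) {B : Finset (Fin n)}
    {d : Fin n} (hi : i ∉ B) (hj : j ∈ B) (hd : d ∈ B) (hdj : d ≠ j) :
    arcWt z t B i d = t * arcWt z t (swapSet i j B) j d := by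
  have hdi : d ≠ i := fun h => hi (h ▸ hd)
  have hd' : d ∈ swapSet i j B := by
    rw [mem_swapSet, Equiv.swap_apply_of_ne_of_ne hdi hdj]; exact hd
  have hj' : j ∉ swapSet i j B := by simpa [mem_swapSet] using hi
  have hi' : i ∈ swapSet i j B := by simpa [mem_swapSet] using hj
  have hine : i ≠ j := by rw [ne_eq, Fin.ext_iff]; omega
  rw [arcWt_eq ht z hi hd, arcWt_eq ht z hj' hd', leftCount_succ hij, if_pos hi',
    leftCount_swapSet hij _ hdj, leftCount_swapSet hij _ hine, Finset.card_map]
  have : d < j ↔ d < i := by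
    rw [ne_eq, Fin.ext_iff] at hdi hdj
    simp only [Fin.lt_def]; omega
  simp only [this, pow_succ]
  field_simp

theorem matchSum_erase_swapSet {t : K} (ht : t ≠ 0) (z : K) (hij : (j : ℕ) = i + 1)
    {A B C : Finset (Fin n)} (hAB : Disjoint A B) (hC : C ⊆ B) (hiA : i ∉ A) (hjA : j ∉ A)
    (hB : ¬ (i ∈ B ∧ j ∈ B)) :
    matchSum z t A (swapSet i j B) (swapSet i j C) = matchSum z t A B C := by
  have := matchSum_map ht z (Equiv.swap i j) hAB hC fun c hc =>
    strictMonoOn_swap hij (S := insert c (B : Set (Fin n))) (by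
      rintro ⟨h1, h2⟩
      have : i ≠ c := fun h => hiA (h ▸ hc)
      have : j ≠ c := fun h => hjA (h ▸ hc)
      simp_all)
  rwa [show A.map (Equiv.swap i j).toEmbedding = A from swapSet_eq_self (by simp [hiA, hjA])] at this

theorem erase_swapSet {B : Finset (Fin n)} {d : Fin n} (hi : d ≠ i) (hj : d ≠ j) :
    (swapSet i j B).erase d = swapSet i j (B.erase d) := by
  rw [swapSet, swapSet, Finset.map_erase]
  simp [Equiv.swap_apply_of_ne_of_ne hi hj]

/-- Place the ball at `i` first. Every arc from `i` skips the free ball at `j`. After the exchange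
the arc starts at `j`, and the free ball at `i`, the last one on the way round, is never skipped.
The remaining matchings are relabelled in an order-preserving way. -/
theorem matchSum_top_bottom {t : K} (ht : t ≠ 0) (z : K) (hij : (j : ℕ) = i + 1)
    {A B C : Finset (Fin n)} (hAB : Disjoint A B) (hC : C ⊆ B) (hi : i ∈ A) (hj : j ∈ B)
    (hjC : j ∉ C) :
    matchSum z t A B C = t * matchSum z t (swapSet i j A) (swapSet i j B) (swapSet i j C) := by
  have hiB := Finset.disjoint_left.1 hAB hi
  have hjA := Finset.disjoint_right.1 hAB hj
  have hine : i ≠ j := by rw [ne_eq, Fin.ext_iff]; omega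
  obtain ⟨A, hiA, rfl⟩ : ∃ A', i ∉ A' ∧ A = insert i A' :=
    ⟨A.erase i, by simp, (Finset.insert_erase hi).symm⟩
  have hjA' : j ∉ A := fun h => hjA (by simp [h])
  have hAB' : Disjoint A B := hAB.mono_left (Finset.subset_insert _ _)
  have hsA : swapSet i j (insert i A) = insert j A := by
    rw [swapSet, Finset.map_insert]
    congr 1
    · simp
    · exact swapSet_eq_self (by simp [hiA, hjA'])
  have hsC : swapSet i j C = C := swapSet_eq_self (by
    have : i ∉ C := fun h => hiB (hC h)
    simp [this, hjC])
  have hsAB : Disjoint A (swapSet i j B) := by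
    rw [Finset.disjoint_left]
    intro x hx
    rw [mem_swapSet, Equiv.swap_apply_of_ne_of_ne (fun h : x = i => hiA (h ▸ hx))
      (fun h : x = j => hjA' (h ▸ hx))]
    exact Finset.disjoint_left.1 hAB' hx
  rw [hsA, matchSum_insert ht z hiA hiB hAB' hC, hsC, matchSum_insert ht z hjA'
    (by simpa [mem_swapSet] using hiB) hsAB (by rw [← hsC]; exact Finset.map_subset_map.2 hC),
    Finset.mul_sum]
  refine Finset.sum_congr rfl fun d hd => ?_
  have hdj : d ≠ j := fun h => hjC (h ▸ hd)
  have hdi : d ≠ i := fun h => hiB (hC (h ▸ hd))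
  have hm := matchSum_erase_swapSet ht z hij (hAB'.mono_right (Finset.erase_subset d _))
      (Finset.erase_subset_erase d hC) hiA hjA' (fun h => hiB (Finset.mem_of_mem_erase h.1))
  rw [← erase_swapSet (B := C) hdi hdj, hsC] at hm
  rw [arcWt_swapSet ht z hij hiB hj (hC hd) hdj, erase_swapSet hdi hdj, hm]
  ring

/-- Arcs from `i` to partners other than `j` behave as in `matchSum_top_bottom`. With `b = B.card`,
the arc from `i` to `j` weighs `(1 - t) / (1 - z t ^ b)`. After the exchange it wraps around from
`j` to `i`, and `t` times its weight is `(1 - t) z t ^ b / (1 - z t ^ b)`. The difference is `1 -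
t`, times the matchings of the other balls. -/
theorem matchSum_top_target {t : K} (ht : t ≠ 0) (z : K) (hij : (j : ℕ) = i + 1)
    {A B C : Finset (Fin n)} (hAB : Disjoint A B) (hC : C ⊆ B) (hi : i ∈ A) (hj : j ∈ C)
    (hz : 1 - z * t ^ B.card ≠ 0) :
    matchSum z t A B C = t * matchSum z t (swapSet i j A) (swapSet i j B) (swapSet i j C) +
      (1 - t) * matchSum z t (A.erase i) (B.erase j) (C.erase j) := by
  have hiB := Finset.disjoint_left.1 hAB hi
  have hjB := hC hj
  have hjA := Finset.disjoint_right.1 hAB hjB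
  have hine : i ≠ j := by rw [ne_eq, Fin.ext_iff]; omega
  obtain ⟨A, hiA, rfl⟩ : ∃ A', i ∉ A' ∧ A = insert i A' :=
    ⟨A.erase i, by simp, (Finset.insert_erase hi).symm⟩
  have hjA' : j ∉ A := fun h => hjA (by simp [h])
  have hAB' : Disjoint A B := hAB.mono_left (Finset.subset_insert _ _)
  have hsA : swapSet i j (insert i A) = insert j A := by
    rw [swapSet, Finset.map_insert]
    congr 1
    · simp
    · exact swapSet_eq_self (by simp [hiA, hjA'])
  have hsAB : Disjoint A (swapSet i j B) := by
    rw [Finset.disjoint_left]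
    intro x hx
    rw [mem_swapSet, Equiv.swap_apply_of_ne_of_ne (fun h : x = i => hiA (h ▸ hx))
      (fun h : x = j => hjA' (h ▸ hx))]
    exact Finset.disjoint_left.1 hAB' hx
  have hjsB : j ∉ swapSet i j B := by simpa [mem_swapSet] using hiB
  have hisB : i ∈ swapSet i j B := by simpa [mem_swapSet] using hjB
  have her : ∀ S : Finset (Fin n), i ∉ S → (swapSet i j S).erase i = S.erase j := by
    intro S hS
    ext x
    rw [Finset.mem_erase, Finset.mem_erase, mem_swapSet, Equiv.swap_apply_def]
    split_ifs with h1 h2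
    · simp [h1, hS]
    · simp [h2, hS]
    · simp [h1, h2]
  have hiC : i ∉ C := fun h => hiB (hC h)
  rw [hsA, matchSum_insert ht z hiA hiB hAB' hC, matchSum_insert ht z hjA'
    hjsB hsAB (Finset.map_subset_map.2 hC),
    Finset.sum_map, Finset.mul_sum, Finset.erase_insert hiA, ← Finset.add_sum_erase C _ hj,
    ← Finset.add_sum_erase C _ hj]
  have hrest : ∑ d ∈ C.erase j, arcWt z t B i d * matchSum z t A (B.erase d) (C.erase d) =
      ∑ d ∈ C.erase j, t * (arcWt z t (swapSet i j B) j ((Equiv.swap i j).toEmbedding d) *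
        matchSum z t A ((swapSet i j B).erase ((Equiv.swap i j).toEmbedding d))
          ((swapSet i j C).erase ((Equiv.swap i j).toEmbedding d))) := by
    refine Finset.sum_congr rfl fun d hd => ?_
    rw [Finset.mem_erase] at hd
    have hdi : d ≠ i := fun h => hiB (hC (h ▸ hd.2))
    have e : (Equiv.swap i j).toEmbedding d = d := Equiv.swap_apply_of_ne_of_ne hdi hd.1
    rw [e, erase_swapSet hdi hd.1, erase_swapSet hdi hd.1,
      arcWt_swapSet ht z hij hiB hjB (hC hd.2) hd.1,
      matchSum_erase_swapSet ht z hij (hAB'.mono_right (Finset.erase_subset _ _))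
      (Finset.erase_subset_erase _ hC) hiA hjA' (fun h => hiB (Finset.mem_of_mem_erase h.1))]
    ring
  have e : (Equiv.swap i j).toEmbedding j = i := by simp
  rw [hrest, e, her B hiB, her C hiC, arcWt_eq ht z hiB hjB, arcWt_eq ht z hjsB hisB,
    if_neg (by rw [Fin.lt_def]; omega), if_pos (by rw [Fin.lt_def]; omega), Finset.card_map,
    leftCount_succ hij (swapSet i j B), if_pos hisB, leftCount_succ hij B, if_neg hiB]
  have g1 := pow_ne_zero (leftCount B i) ht
  have g2 := pow_ne_zero (leftCount (swapSet i j B) i) ht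
  rw [add_zero, pow_succ]
  field_simp
  ring

/-- Only the ball that ends at `j` matters: it skips the free ball at `i`, and stopping at `i`
instead saves this skip. Afterwards one of the two columns is no longer free, and the exchange
preserves the order for the balls still to be placed. -/
theorem fillSum_bottom_target {t : K} (ht : t ≠ 0) (z : K) (hij : (j : ℕ) = i + 1) :
    ∀ (l : List (Fin n)) {B C : Finset (Fin n)}, (∀ c ∈ l, c ∉ B) → C ⊆ B → i ∈ B → i ∉ C → j ∈ C →
      fillSum z t l B C = t * fillSum z t l (swapSet i j B) (swapSet i j C)
  | [], B, C, _, _, _, _, hj => by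
    have h : C ≠ ∅ := Finset.ne_empty_of_mem hj
    simp [fillSum, h]
  | c :: l, B, C, hl, hC, hiB, hiC, hj => by
    have hjB := hC hj
    have hine : i ≠ j := by rw [ne_eq, Fin.ext_iff]; omega
    have hl' : ∀ d, ∀ x ∈ l, x ∉ B.erase d := fun d x hx h =>
      hl x (List.mem_cons_of_mem _ hx) (Finset.mem_of_mem_erase h)
    have hc := hl c (by simp)
    have hBs : swapSet i j B = B := swapSet_eq_self (by simp [hiB, hjB])
    rw [fillSum, fillSum, Finset.sum_map, Finset.mul_sum]
    refine Finset.sum_congr rfl fun d hd => ?_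
    by_cases hdj : d = j
    · subst hdj
      have e : (Equiv.swap i d).toEmbedding d = i := by simp
      have hci : c ≠ i := fun h => hc (h ▸ hiB)
      have hcd : c ≠ d := fun h => hc (h ▸ hjB)
      have hm := fillSum_map ht z (Equiv.swap i d) l (hl' d) (Finset.erase_subset_erase d hC)
        fun x hx => strictMonoOn_swap hij (by
          have : d ≠ x := fun h => hl x (List.mem_cons_of_mem _ hx) (h ▸ hjB)
          simp [this])
      have hlm : l.map (Equiv.swap i d) = l := by
        refine (List.map_congr_left fun x hx => ?_).trans (List.map_id l)
        exact Equiv.swap_apply_of_ne_of_ne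
          (fun h => hl x (List.mem_cons_of_mem _ hx) (h ▸ hiB))
          (fun h => hl x (List.mem_cons_of_mem _ hx) (h ▸ hjB))
      rw [hlm, Finset.map_erase, Finset.map_erase, e] at hm
      rw [e, hm, hBs, arcWt_eq ht z hc hjB, arcWt_eq ht z hc hiB, leftCount_succ hij, if_pos hiB]
      have : d < c ↔ i < c := by
        rw [ne_eq, Fin.ext_iff] at hci hcd
        simp only [Fin.lt_def]; omega
      simp only [this, pow_succ]
      ring
    · have hdi : d ≠ i := fun h => hiC (h ▸ hd)
      have e : (Equiv.swap i j).toEmbedding d = d := Equiv.swap_apply_of_ne_of_ne hdi hdj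
      rw [e, erase_swapSet hdi hdj, erase_swapSet hdi hdj,
        fillSum_bottom_target ht z hij l (hl' d) (Finset.erase_subset_erase d hC)
          (by simp [hiB, hdi.symm]) (by simp [hiC]) (by simp [hj, Ne.symm hdj]), hBs]
      ring

end AdjacentSwap

/-! ### The weight of one label, with its trivial pairings. -/

section LevelWeight

variable {K : Type*} [Field K] {n : ℕ}

/-- The weight of one label: `A` holds the balls of the upper row with this label, `B` the balls of
the lower row that are free for them, and `C` the partners. -/
noncomputable def levelWt (z t : K) (A B C : Finset (Fin n)) : K :=
  if A ∩ B ⊆ C then matchSum z t (A \ B) (B \ A) (C \ A) else 0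

/-- An upper ball over a free ball is paired trivially, so the latter has to be a partner. Once
these pairings are placed, `A \ B`, `B \ A` and `C \ A` are left. -/
theorem levelWt_eq_zero (z t : K) {A B C : Finset (Fin n)} {x : Fin n} (hA : x ∈ A) (hB : x ∈ B)
    (hC : x ∉ C) : levelWt z t A B C = 0 :=
  if_neg fun h => hC (h (Finset.mem_inter.2 ⟨hA, hB⟩))

theorem levelWt_eq_zero_of_card (z t : K) {A B C : Finset (Fin n)} (hC : C ⊆ B)
    (h : A.card ≠ C.card) : levelWt z t A B C = 0 := by
  unfold levelWt
  split_ifs with hs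
  · refine fillSum_eq_zero_of_card z t _ _ _ ?_
    rw [Finset.length_toList]
    have h1 := Finset.card_sdiff_add_card_inter A B
    have h2 := Finset.card_sdiff_add_card_inter C A
    have h3 : C ∩ A = A ∩ B := by
      ext x
      simp only [Finset.mem_inter]
      exact ⟨fun h => ⟨h.2, hC h.1⟩, fun h => ⟨hs (Finset.mem_inter.2 h), h.1⟩⟩
    rw [h3] at h2
    omega
  · rfl

section Swap

variable {i j : Fin n}

theorem matchSum_bottom_target {t : K} (ht : t ≠ 0) (z : K) (hij : (j : ℕ) = i + 1)
    {A B C : Finset (Fin n)} (hAB : Disjoint A B) (hC : C ⊆ B) (hi : i ∈ B) (hiC : i ∉ C)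
    (hj : j ∈ C) :
    matchSum z t A B C = t * matchSum z t (swapSet i j A) (swapSet i j B) (swapSet i j C) := by
  have hA : swapSet i j A = A := swapSet_eq_self (by
    simp [Finset.disjoint_right.1 hAB hi, Finset.disjoint_right.1 hAB (hC hj)])
  rw [hA]
  exact fillSum_bottom_target ht z hij _
    (fun c hc => Finset.disjoint_left.1 hAB (by simpa using hc)) hC hi hiC hj

theorem levelWt_map_eq (φ : Equiv.Perm (Fin n)) (z t : K) (A B C : Finset (Fin n)) :
    levelWt z t (A.map φ.toEmbedding) (B.map φ.toEmbedding) (C.map φ.toEmbedding) =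
      if A ∩ B ⊆ C then matchSum z t ((A \ B).map φ.toEmbedding) ((B \ A).map φ.toEmbedding)
        ((C \ A).map φ.toEmbedding) else 0 := by
  unfold levelWt
  simp only [← Finset.map_inter, ← Finset.map_sdiff, Finset.map_subset_map]

theorem disjoint_sdiff_swap (A B : Finset (Fin n)) : Disjoint (A \ B) (B \ A) := by
  rw [Finset.disjoint_left]
  intro x hx hx'
  simp only [Finset.mem_sdiff] at hx hx'
  exact hx.2 hx'.1

/-- If both columns lie in `B \ A`, the exchange fixes all three sets. Otherwise no set `{c} ∪ (B \
A)` with `c ∈ A \ B` contains both columns, and the exchange preserves its order. Two adjacent upper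
balls are harmless, because arcs are compared with free balls only. -/
theorem levelWt_swap {t : K} (ht : t ≠ 0) (z : K) (hij : (j : ℕ) = i + 1)
    {A B C : Finset (Fin n)} (hC : C ⊆ B) (h₁ : ¬ (i ∈ A ∧ i ∉ B ∧ j ∈ B ∧ j ∉ A))
    (h₂ : ¬ (j ∈ A ∧ j ∉ B ∧ i ∈ B ∧ i ∉ A))
    (h₃ : i ∈ B → j ∈ B → i ∉ A → j ∉ A → (i ∈ C ↔ j ∈ C)) :
    levelWt z t (swapSet i j A) (swapSet i j B) (swapSet i j C) = levelWt z t A B C := by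
  by_cases hb : i ∈ B \ A ∧ j ∈ B \ A
  · simp only [Finset.mem_sdiff] at hb
    rw [swapSet_eq_self (S := A) (by simp [hb]), swapSet_eq_self (S := B) (by simp [hb]),
      swapSet_eq_self (S := C) (h₃ hb.1.1 hb.2.1 hb.1.2 hb.2.2)]
  · rw [levelWt_map_eq, levelWt]
    congr 1
    refine matchSum_map ht z _ (disjoint_sdiff_swap A B) (Finset.sdiff_subset_sdiff hC le_rfl)
      fun c hc => strictMonoOn_swap hij ?_
    have hine : i ≠ j := by rw [ne_eq, Fin.ext_iff]; omega
    rintro ⟨hi, hj⟩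
    simp only [Set.mem_insert_iff, Finset.coe_sdiff, Set.mem_sdiff, Finset.mem_coe,
      Finset.mem_sdiff] at *
    rcases hi with rfl | hi
    · rcases hj with rfl | hj
      · exact hine rfl
      · exact h₁ ⟨hc.1, hc.2, hj⟩
    · rcases hj with rfl | hj
      · exact h₂ ⟨hc.1, hc.2, hi⟩
      · exact hb ⟨hi, hj⟩

theorem levelWt_top_bottom {t : K} (ht : t ≠ 0) (z : K) (hij : (j : ℕ) = i + 1)
    {A B C : Finset (Fin n)} (hC : C ⊆ B) (hi : i ∈ A) (hiB : i ∉ B) (hj : j ∈ B) (hjA : j ∉ A)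
    (hjC : j ∉ C) :
    levelWt z t A B C = t * levelWt z t (swapSet i j A) (swapSet i j B) (swapSet i j C) := by
  rw [levelWt_map_eq, levelWt]
  split_ifs
  · exact matchSum_top_bottom ht z hij (disjoint_sdiff_swap A B)
      (Finset.sdiff_subset_sdiff hC le_rfl) (by simp [hi, hiB]) (by simp [hj, hjA]) (by simp [hjC])
  · rw [mul_zero]

theorem levelWt_bottom_target {t : K} (ht : t ≠ 0) (z : K) (hij : (j : ℕ) = i + 1)
    {A B C : Finset (Fin n)} (hC : C ⊆ B) (hi : i ∈ B) (hiA : i ∉ A) (hiC : i ∉ C) (hj : j ∈ C)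
    (hjA : j ∉ A) :
    levelWt z t A B C = t * levelWt z t (swapSet i j A) (swapSet i j B) (swapSet i j C) := by
  rw [levelWt_map_eq, levelWt]
  split_ifs
  · exact matchSum_bottom_target ht z hij (disjoint_sdiff_swap A B)
      (Finset.sdiff_subset_sdiff hC le_rfl) (by simp [hi, hiA]) (by simp [hiC]) (by simp [hj, hjA])
  · rw [mul_zero]

/-- In the last term the upper ball has moved over the partner at `j` and is paired trivially. This
removes both from the nontrivial matching and so produces the last term of `matchSum_top_target`. -/
theorem levelWt_top_target {t : K} (ht : t ≠ 0) (z : K) (hz : ∀ k : ℕ, 1 - z * t ^ k ≠ 0)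
    (hij : (j : ℕ) = i + 1) {A B C : Finset (Fin n)} (hC : C ⊆ B) (hi : i ∈ A) (hiB : i ∉ B)
    (hj : j ∈ C) (hjA : j ∉ A) :
    levelWt z t A B C = t * levelWt z t (swapSet i j A) (swapSet i j B) (swapSet i j C) +
      (1 - t) * levelWt z t (swapSet i j A) B C := by
  have hmem : ∀ x, x ∈ swapSet i j A ↔ x = j ∨ (x ≠ i ∧ x ∈ A) := by
    intro x
    rw [mem_swapSet, Equiv.swap_apply_def]
    have hine : i ≠ j := by rw [ne_eq, Fin.ext_iff]; omega
    split_ifs with h1 h2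
    · simp [h1, hjA, hine]
    · simp [h2, hi]
    · simp [h1, h2]
  have hjB := hC hj
  have e1 : swapSet i j A ∩ B ⊆ C ↔ A ∩ B ⊆ C := by
    constructor
    · intro h x hx
      rw [Finset.mem_inter] at hx
      refine h (Finset.mem_inter.2 ⟨(hmem x).2 (Or.inr ⟨fun h' => hiB (h' ▸ hx.2), hx.1⟩), hx.2⟩)
    · intro h x hx
      rw [Finset.mem_inter, hmem] at hx
      rcases hx.1 with rfl | h'
      · exact hj
      · exact h (Finset.mem_inter.2 ⟨h'.2, hx.2⟩)
  have e2 : swapSet i j A \ B = (A \ B).erase i := by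
    ext x
    simp only [Finset.mem_sdiff, Finset.mem_erase, hmem]
    constructor
    · rintro ⟨rfl | h, h'⟩
      · exact absurd hjB h'
      · exact ⟨h.1, h.2, h'⟩
    · rintro ⟨h1, h2, h3⟩
      exact ⟨Or.inr ⟨h1, h2⟩, h3⟩
  have e3 : ∀ S : Finset (Fin n), i ∉ S → S \ swapSet i j A = (S \ A).erase j := by
    intro S hS
    ext x
    simp only [Finset.mem_sdiff, Finset.mem_erase, hmem]
    constructor
    · rintro ⟨h1, h2⟩
      have : x ≠ i := fun h => hS (h ▸ h1)
      tauto
    · rintro ⟨h1, h2, h3⟩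
      tauto
  rw [levelWt_map_eq, levelWt, levelWt, e2, e3 B hiB, e3 C (fun h => hiB (hC h))]
  simp only [e1]
  split_ifs
  · exact matchSum_top_target ht z hij (disjoint_sdiff_swap A B)
      (Finset.sdiff_subset_sdiff hC le_rfl) (by simp [hi, hiB]) (by simp [hj, hjA]) (hz _)
  · simp

end Swap

/-! ### Cyclic rotation of the columns. -/

section Rotation

variable [NeZero n]

theorem add_one_lt_add_one_iff_of_ne {c d : Fin n} (hc : c + 1 ≠ 0) (hd : d + 1 ≠ 0) :
    d + 1 < c + 1 ↔ d < c := by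
  have key : ∀ x : Fin n, x + 1 ≠ 0 → (x + 1).val = x.val + 1 := by
    intro x hx
    refine Fin.val_add_one_of_lt' ?_
    have hx2 := x.2
    by_contra h
    apply hx
    have : x.val + 1 = n := by omega
    rw [Fin.ext_iff, Fin.val_add, Fin.val_one', Nat.add_mod_mod, this]
    simp
  rw [Fin.lt_def, Fin.lt_def, key _ hc, key _ hd]
  omega

theorem lt_of_add_one_eq_zero {c d : Fin n} (hc : c + 1 = 0) (hd : d ≠ c) : d < c := by
  have hx : c.val + 1 = n := by
    by_contra h
    have h2 : c.val + 1 < n := by have := c.2; omega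
    have := Fin.val_add_one_of_lt' h2
    rw [hc] at this
    simp at this
  rw [ne_eq, Fin.ext_iff] at hd
  rw [Fin.lt_def]; have := d.2; omega

/-- Skipping depends on cyclic differences only. An arc from the last column wraps around before the
rotation but not after it; an arc into the last column wraps only after it. -/
theorem arcWt_rotate (z t : K) (B : Finset (Fin n)) {c d : Fin n} (h : d ≠ c) :
    (if c + 1 = 0 then z else 1) *
        arcWt z t (B.map (Equiv.addRight (1 : Fin n)).toEmbedding) (c + 1) (d + 1) =
      (if d + 1 = 0 then z else 1) * arcWt z t B c d := by
  have hw : (if c + 1 = 0 then z else 1) * (if d + 1 < c + 1 then z else 1) =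
      (if d + 1 = 0 then z else 1) * (if d < c then z else 1) := by
    by_cases hc : c + 1 = 0
    · have hd : d + 1 ≠ 0 := fun hd => h (add_right_cancel (hd.trans hc.symm))
      rw [if_pos hc, if_neg hd, if_pos (lt_of_add_one_eq_zero hc h), hc, if_neg (by simp)]
      ring
    · by_cases hd : d + 1 = 0
      · rw [if_neg hc, if_pos hd, if_neg (lt_of_add_one_eq_zero hd h.symm).not_gt, hd,
          if_pos (Fin.pos_iff_ne_zero.2 hc)]
        ring
      · rw [if_neg hc, if_neg hd]
        simp only [add_one_lt_add_one_iff_of_ne hc hd]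
  unfold arcWt
  rw [Finset.filter_map, Finset.card_map, Finset.card_map]
  have hf : ({e ∈ B | ((fun e : Fin n => 0 < (e - (c + 1)).val ∧
      (e - (c + 1)).val < (d + 1 - (c + 1)).val) ∘ (Equiv.addRight (1 : Fin n)).toEmbedding) e} :
      Finset (Fin n)) = {e ∈ B | 0 < (e - c).val ∧ (e - c).val < (d - c).val} := by
    refine Finset.filter_congr fun e _ => ?_
    simp [add_sub_add_right_eq_sub]
  rw [hf]
  linear_combination ((1 - t) *
    t ^ ({e ∈ B | 0 < (e - c).val ∧ (e - c).val < (d - c).val} : Finset (Fin n)).card /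
      (1 - z * t ^ B.card)) * hw

theorem fillSum_rotate (z t : K) : ∀ (l : List (Fin n)) {B C : Finset (Fin n)},
    (∀ c ∈ l, c ∉ B) → C ⊆ B →
    (l.map fun c => if c + 1 = 0 then z else 1).prod *
      fillSum z t (l.map (Equiv.addRight (1 : Fin n)))
        (B.map (Equiv.addRight (1 : Fin n)).toEmbedding)
        (C.map (Equiv.addRight (1 : Fin n)).toEmbedding) =
      (∏ d ∈ C, if d + 1 = 0 then z else 1) * fillSum z t l B C
  | [], B, C, _, _ => by
    by_cases h : C = ∅ <;> simp [fillSum, h]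
  | c :: l, B, C, hl, hC => by
    simp only [List.map_cons, List.prod_cons, fillSum, Finset.sum_map, Finset.mul_sum]
    refine Finset.sum_congr rfl fun d hd => ?_
    rw [← Finset.map_erase, ← Finset.map_erase, ← Finset.mul_prod_erase C _ hd]
    have ih := fillSum_rotate z t l
      (fun x hx h' => hl x (List.mem_cons_of_mem _ hx) (Finset.mem_of_mem_erase h'))
      (Finset.erase_subset_erase d hC)
    have ha := arcWt_rotate z t B (c := c) (d := d) (fun h => hl c (by simp) (h ▸ hC hd))
    simp only [Equiv.coe_toEmbedding, Equiv.coe_addRight] at ih ⊢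
    linear_combination (arcWt z t (B.map (Equiv.addRight (1 : Fin n)).toEmbedding) (c + 1) (d + 1) *
      (if c + 1 = 0 then z else 1)) * ih + ((∏ d ∈ C.erase d, if d + 1 = 0 then z else 1) *
        fillSum z t l (B.erase d) (C.erase d)) * ha

/-- `fillSum_rotate` gives the factors for `A \ B` and `C \ A`. The trivial pairings occupy `A ∩ B =
C ∩ A` and contribute equally to both products. -/
theorem levelWt_rotate {t : K} (ht : t ≠ 0) (z : K) {A B C : Finset (Fin n)} (hC : C ⊆ B) :
    (∏ c ∈ A, if c + 1 = 0 then z else 1) *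
      levelWt z t (A.map (Equiv.addRight (1 : Fin n)).toEmbedding)
        (B.map (Equiv.addRight (1 : Fin n)).toEmbedding)
        (C.map (Equiv.addRight (1 : Fin n)).toEmbedding) =
      (∏ d ∈ C, if d + 1 = 0 then z else 1) * levelWt z t A B C := by
  rw [levelWt_map_eq, levelWt]
  split_ifs with h
  · have h3 : C ∩ A = A ∩ B := by
      ext x
      simp only [Finset.mem_inter]
      exact ⟨fun h => ⟨h.2, hC h.1⟩, fun h' => ⟨h (Finset.mem_inter.2 h'), h'.1⟩⟩
    have hm : matchSum z t ((A \ B).map (Equiv.addRight (1 : Fin n)).toEmbedding)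
        ((B \ A).map (Equiv.addRight (1 : Fin n)).toEmbedding)
        ((C \ A).map (Equiv.addRight (1 : Fin n)).toEmbedding) =
        fillSum z t ((A \ B).toList.map (Equiv.addRight (1 : Fin n)))
        ((B \ A).map (Equiv.addRight (1 : Fin n)).toEmbedding)
        ((C \ A).map (Equiv.addRight (1 : Fin n)).toEmbedding) := by
      refine fillSum_perm ht z ?_ ?_ ?_
      · refine (List.perm_ext_iff_of_nodup (Finset.nodup_toList _)
          ((Finset.nodup_toList _).map (Equiv.injective _))).2 fun a => ?_
        simp only [Finset.mem_toList, Finset.mem_map_equiv, List.mem_map]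
        exact ⟨fun h => ⟨_, h, by simp⟩, fun ⟨x, hx, e⟩ => by simpa [← e] using hx⟩
      · intro c hc
        simp only [Finset.mem_toList, Finset.mem_map_equiv] at hc ⊢
        exact Finset.disjoint_left.1 (disjoint_sdiff_swap A B) hc
      · exact Finset.map_subset_map.2 (Finset.sdiff_subset_sdiff hC le_rfl)
    have hf := fillSum_rotate z t (A \ B).toList (B := B \ A) (C := C \ A)
      (fun c hc => Finset.disjoint_left.1 (disjoint_sdiff_swap A B) (by simpa using hc))
      (Finset.sdiff_subset_sdiff hC le_rfl)
    rw [Finset.prod_map_toList] at hf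
    rw [hm, ← Finset.prod_inter_mul_prod_sdiff A B, ← Finset.prod_inter_mul_prod_sdiff C A, h3,
      mul_assoc, hf, mul_assoc]
    rfl
  · rw [mul_zero, mul_zero]

end Rotation

end LevelWeight

/-! ### From ordered placements to sums over bijections. -/

section Matchings

variable {K : Type*} [Field K] {n : ℕ}

/-- The bijections from `A` to `C`, as partial functions. -/
def matchings (A C : Finset (Fin n)) : Finset (Fin n → Option (Fin n)) :=
  {τ | (∀ c, (τ c).isSome = true ↔ c ∈ A) ∧ (∀ c d, τ c = some d → d ∈ C) ∧
    (∀ d ∈ C, ∃ c, τ c = some d) ∧ ∀ c₁ c₂ d, τ c₁ = some d → τ c₂ = some d → c₁ = c₂}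

theorem mem_matchings {A C : Finset (Fin n)} {τ : Fin n → Option (Fin n)} :
    τ ∈ matchings A C ↔ (∀ c, (τ c).isSome = true ↔ c ∈ A) ∧ (∀ c d, τ c = some d → d ∈ C) ∧
      (∀ d ∈ C, ∃ c, τ c = some d) ∧ ∀ c₁ c₂ d, τ c₁ = some d → τ c₂ = some d → c₁ = c₂ := by
  simp [matchings]

theorem eq_none_of_mem_matchings {A C : Finset (Fin n)} {τ : Fin n → Option (Fin n)}
    (h : τ ∈ matchings A C) {c : Fin n} (hc : c ∉ A) : τ c = none := by
  rw [← Option.not_isSome_iff_eq_none, (mem_matchings.1 h).1]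
  exact hc

/-- The weight of a matching of the balls in the columns `A`, placed from right to left. -/
def matchingWt (z t : K) (A B : Finset (Fin n)) (τ : Fin n → Option (Fin n)) : K :=
  ∏ c ∈ A, arcWt z t {d ∈ B | ∀ b, τ b = some d → ¬ c < b} c ((τ c).getD c)

theorem update_mem_matchings {A C : Finset (Fin n)} {c d : Fin n} (hc : c ∉ A) (hd : d ∈ C)
    {τ : Fin n → Option (Fin n)} (hτ : τ ∈ matchings A (C.erase d)) :
    Function.update τ c (some d) ∈ matchings (insert c A) C := by
  have hn := eq_none_of_mem_matchings hτ hc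
  obtain ⟨h1, h2, h3, h4⟩ := mem_matchings.1 hτ
  refine mem_matchings.2 ⟨?_, ?_, ?_, ?_⟩
  · intro x
    by_cases hx : x = c
    · simp [hx]
    · simp [hx, h1]
  · intro x e
    by_cases hx : x = c
    · subst hx
      simp only [Function.update_self, Option.some.injEq]
      rintro rfl; exact hd
    · rw [Function.update_of_ne hx]
      exact fun h => Finset.mem_of_mem_erase (h2 _ _ h)
  · intro e he
    by_cases hed : e = d
    · exact ⟨c, by simp [hed]⟩
    · obtain ⟨x, hx⟩ := h3 e (Finset.mem_erase.2 ⟨hed, he⟩)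
      have : x ≠ c := by rintro rfl; rw [hn] at hx; cases hx
      exact ⟨x, by rwa [Function.update_of_ne this]⟩
  · intro x y e hx hy
    by_cases hxc : x = c <;> by_cases hyc : y = c
    · rw [hxc, hyc]
    · rw [hxc, Function.update_self, Option.some.injEq] at hx
      rw [Function.update_of_ne hyc] at hy
      exact absurd (h2 _ _ hy) (by simp [hx])
    · rw [hyc, Function.update_self, Option.some.injEq] at hy
      rw [Function.update_of_ne hxc] at hx
      exact absurd (h2 _ _ hx) (by simp [hy])
    · rw [Function.update_of_ne hyc] at hy
      rw [Function.update_of_ne hxc] at hx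
      exact h4 _ _ _ hx hy

theorem erase_mem_matchings {A C : Finset (Fin n)} {c d : Fin n} (hc : c ∉ A)
    {τ : Fin n → Option (Fin n)} (hτ : τ ∈ matchings (insert c A) C) (hd : τ c = some d) :
    Function.update τ c none ∈ matchings A (C.erase d) := by
  obtain ⟨h1, h2, h3, h4⟩ := mem_matchings.1 hτ
  have hsome : ∀ x e, Function.update τ c none x = some e → x ≠ c ∧ τ x = some e := by
    intro x e hx
    by_cases hxc : x = c
    · simp [hxc] at hx
    · rw [Function.update_of_ne hxc] at hx
      exact ⟨hxc, hx⟩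
  refine mem_matchings.2 ⟨?_, ?_, ?_, ?_⟩
  · intro x
    by_cases hx : x = c
    · simp [hx, hc]
    · simp [hx, h1]
  · intro x e hx
    obtain ⟨hxc, hx⟩ := hsome x e hx
    refine Finset.mem_erase.2 ⟨?_, h2 _ _ hx⟩
    rintro rfl
    exact hxc (h4 _ _ _ hx hd)
  · intro e he
    rw [Finset.mem_erase] at he
    obtain ⟨x, hx⟩ := h3 e he.2
    have : x ≠ c := by
      rintro rfl
      rw [hd, Option.some.injEq] at hx
      exact he.1 hx.symm
    exact ⟨x, by rwa [Function.update_of_ne this]⟩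
  · intro x y e hx hy
    exact h4 _ _ _ (hsome _ _ hx).2 (hsome _ _ hy).2

theorem matchingWt_insert (z t : K) {A B C : Finset (Fin n)} {c d : Fin n} (hc : ∀ x ∈ A, x < c)
    {τ : Fin n → Option (Fin n)} (hτ : τ ∈ matchings A (C.erase d)) :
    matchingWt z t (insert c A) B (Function.update τ c (some d)) =
      arcWt z t B c d * matchingWt z t A (B.erase d) τ := by
  have hcA : c ∉ A := fun h => lt_irrefl _ (hc c h)
  have hn := eq_none_of_mem_matchings hτ hcA
  unfold matchingWt
  rw [Finset.prod_insert hcA]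
  congr 1
  · have : ({e ∈ B | ∀ b, Function.update τ c (some d) b = some e → ¬ c < b} : Finset (Fin n)) =
        B := by
      refine Finset.filter_true_of_mem fun e _ b hb hcb => ?_
      rw [Function.update_of_ne hcb.ne'] at hb
      have : b ∈ A := ((mem_matchings.1 hτ).1 b).1 (by simp [hb])
      exact (hc b this).not_gt hcb
    rw [this, Function.update_self, Option.getD_some]
  · refine Finset.prod_congr rfl fun x hx => ?_
    have hxc : x ≠ c := (hc x hx).ne
    rw [Function.update_of_ne hxc]
    congr 1
    ext e
    simp only [Finset.mem_filter, Finset.mem_erase]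
    constructor
    · rintro ⟨he, h⟩
      refine ⟨⟨?_, he⟩, ?_⟩
      · rintro rfl
        exact h c (by simp) (hc x hx)
      · intro b hb
        have : b ≠ c := by rintro rfl; rw [hn] at hb; cases hb
        exact h b (by rwa [Function.update_of_ne this])
    · rintro ⟨⟨h1, h2⟩, h3⟩
      refine ⟨h2, fun b hb => ?_⟩
      by_cases hbc : b = c
      · rw [hbc, Function.update_self, Option.some.injEq] at hb
        exact absurd hb.symm h1
      · rw [Function.update_of_ne hbc] at hb
        exact h3 b hb

/-- Induction on the largest column of `A`: its ball is placed first and finds all of `B` free, and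
`matchSum_insert` allows it to be treated first in `matchSum` as well. -/
theorem sum_matchings {t : K} (ht : t ≠ 0) (z : K) (A : Finset (Fin n)) :
    ∀ {B C : Finset (Fin n)}, Disjoint A B → C ⊆ B →
      ∑ τ ∈ matchings A C, matchingWt z t A B τ = matchSum z t A B C := by
  induction A using Finset.induction_on_max with
  | empty =>
    intro B C _ _
    rw [matchSum, Finset.toList_empty, fillSum]
    split_ifs with h
    · have : matchings (∅ : Finset (Fin n)) C = {fun _ => none} := by
        ext τ
        rw [Finset.mem_singleton]
        constructor
        · intro hτ
          funext x
          exact eq_none_of_mem_matchings hτ (by simp)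
        · rintro rfl
          simp [mem_matchings, h]
      rw [this, Finset.sum_singleton]
      simp [matchingWt]
    · refine Finset.sum_eq_zero fun τ hτ => ?_
      obtain ⟨d, hd⟩ := Finset.nonempty_iff_ne_empty.2 h
      obtain ⟨c, hc⟩ := (mem_matchings.1 hτ).2.2.1 d hd
      have := ((mem_matchings.1 hτ).1 c).1 (by simp [hc])
      simp at this
  | insert c A hc ih =>
    intro B C hAB hC
    have hcA : c ∉ A := fun h => lt_irrefl _ (hc c h)
    have hcB : c ∉ B := Finset.disjoint_left.1 hAB (by simp)
    have hAB' : Disjoint A B := hAB.mono_left (Finset.subset_insert _ _)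
    rw [matchSum_insert ht z hcA hcB hAB' hC]
    have : ∀ d ∈ C, arcWt z t B c d * matchSum z t A (B.erase d) (C.erase d) =
        ∑ τ ∈ matchings A (C.erase d), arcWt z t B c d * matchingWt z t A (B.erase d) τ := by
      intro d _
      rw [← Finset.mul_sum, ih (hAB'.mono_right (Finset.erase_subset _ _))
        (Finset.erase_subset_erase _ hC)]
    rw [Finset.sum_congr rfl this, Finset.sum_sigma']
    symm
    refine Finset.sum_bij (fun x _ => Function.update x.2 c (some x.1)) ?_ ?_ ?_ ?_
    · rintro ⟨d, τ⟩ h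
      rw [Finset.mem_sigma] at h
      exact update_mem_matchings hcA h.1 h.2
    · rintro ⟨d, τ⟩ h ⟨d', τ'⟩ h' he
      rw [Finset.mem_sigma] at h h'
      have h1 : d = d' := by
        have := congrFun he c
        simpa using this
      subst h1
      have : τ = τ' := by
        funext x
        by_cases hx : x = c
        · rw [hx]
          exact (eq_none_of_mem_matchings h.2 hcA).trans (eq_none_of_mem_matchings h'.2 hcA).symm
        · have := congrFun he x
          simpa [hx] using this
      rw [this]
    · intro τ hτ
      obtain ⟨d, hd⟩ := Option.isSome_iff_exists.1
        (((mem_matchings.1 hτ).1 c).2 (Finset.mem_insert_self _ _))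
      refine ⟨⟨d, Function.update τ c none⟩, ?_, ?_⟩
      · rw [Finset.mem_sigma]
        exact ⟨(mem_matchings.1 hτ).2.1 c d hd, erase_mem_matchings hcA hτ hd⟩
      · simp only [Function.update_idem]
        rw [← hd, Function.update_eq_self]
    · rintro ⟨d, τ⟩ h
      rw [Finset.mem_sigma] at h
      exact (matchingWt_insert z t hc h.2).symm

end Matchings

/-! ### Factorization of the weight of a row over the labels. -/

section Rows

variable {K : Type*} [Field K] {n : ℕ}

/-- The balls of the upper row with label `k + 2`, when `ν` is the type of the upper row seen as
a bottom row. -/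
def topLevel (ν : Fin n → ℕ) (k : ℕ) : Finset (Fin n) := {c | ν c = k + 1}

/-- The balls of the bottom row with label `k + 2`. -/
def botLevel (μ : Fin n → ℕ) (k : ℕ) : Finset (Fin n) := {c | μ c = k + 2}

/-- The balls of the bottom row with label at most `k + 2`. -/
def freeLevel (μ : Fin n → ℕ) (k : ℕ) : Finset (Fin n) := {c | μ c ≠ 0 ∧ μ c ≤ k + 2}

@[simp] theorem mem_topLevel {ν : Fin n → ℕ} {k : ℕ} {c : Fin n} :
    c ∈ topLevel ν k ↔ ν c = k + 1 := by simp [topLevel]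

@[simp] theorem mem_botLevel {μ : Fin n → ℕ} {k : ℕ} {c : Fin n} :
    c ∈ botLevel μ k ↔ μ c = k + 2 := by simp [botLevel]

@[simp] theorem mem_freeLevel {μ : Fin n → ℕ} {k : ℕ} {c : Fin n} :
    c ∈ freeLevel μ k ↔ μ c ≠ 0 ∧ μ c ≤ k + 2 := by simp [freeLevel]

theorem botLevel_subset (μ : Fin n → ℕ) (k : ℕ) : botLevel μ k ⊆ freeLevel μ k := by
  intro c hc
  rw [mem_botLevel] at hc
  rw [mem_freeLevel]
  omega

/-- The coefficient of `F_ν` in the recursion for `F_μ`. -/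
noncomputable def rowCoeff (q t : K) (L : ℕ) (μ ν : Fin n → ℕ) : K :=
  ∏ k : Fin L, levelWt (q ^ ((k : ℕ) + 1)) t (topLevel ν k) (freeLevel μ k) (botLevel μ k)

/-- `σ` matches a row with labels `ν + 1` (where `ν ≠ 0`) to a bottom row with labels `μ`. -/
structure IsRowMatching (μ ν : Fin n → ℕ) (σ : Fin n → Option (Fin n)) : Prop where
  isSome : ∀ c, (σ c).isSome = true ↔ ν c ≠ 0
  label : ∀ c d, σ c = some d → μ d = ν c + 1
  inj : ∀ c₁ c₂ d, σ c₁ = some d → σ c₂ = some d → c₁ = c₂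
  onto : ∀ d, 2 ≤ μ d → ∃ b, σ b = some d
  triv : ∀ c, ν c ≠ 0 → μ c ≠ 0 → μ c ≤ ν c + 1 → σ c = some c

/-- The balls which are free for the ball in column `c`. -/
def rowFree (μ ν : Fin n → ℕ) (σ : Fin n → Option (Fin n)) (c : Fin n) : Finset (Fin n) :=
  {d | μ d ≠ 0 ∧ ∀ b, σ b = some d →
    ¬ (ν c < ν b ∨ (ν b = ν c ∧ (σ b = some b ∨ c < b)))}

/-- The weight of a row matching. -/
def rowWt (q t : K) (μ ν : Fin n → ℕ) (σ : Fin n → Option (Fin n)) : K :=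
  ∏ c with ν c ≠ 0 ∧ σ c ≠ some c, arcWt (q ^ ν c) t (rowFree μ ν σ c) c ((σ c).getD c)

/-- The nontrivial pairings of label `k + 2`. -/
def levelPart (μ ν : Fin n → ℕ) (σ : Fin n → Option (Fin n)) (k : ℕ) (c : Fin n) :
    Option (Fin n) :=
  if c ∈ topLevel ν k \ freeLevel μ k then σ c else none

/-- The row matching with given nontrivial pairings. -/
def assemble {L : ℕ} (μ ν : Fin n → ℕ) (x : Fin L → Fin n → Option (Fin n)) (c : Fin n) :
    Option (Fin n) :=
  if h : ν c - 1 < L then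
    if ν c = 0 then none else if μ c ≠ 0 ∧ μ c ≤ ν c + 1 then some c else x ⟨ν c - 1, h⟩ c
  else none

theorem levelPart_mem {μ ν : Fin n → ℕ} {σ : Fin n → Option (Fin n)} (h : IsRowMatching μ ν σ)
    (k : ℕ) : levelPart μ ν σ k ∈
      matchings (topLevel ν k \ freeLevel μ k) (botLevel μ k \ topLevel ν k) := by
  have hsome : ∀ c d, levelPart μ ν σ k c = some d →
      c ∈ topLevel ν k \ freeLevel μ k ∧ σ c = some d := by
    intro c d hc
    unfold levelPart at hc
    split_ifs at hc with h1
    exact ⟨h1, hc⟩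
  refine mem_matchings.2 ⟨?_, ?_, ?_, ?_⟩
  · intro c
    unfold levelPart
    split_ifs with h1
    · rw [h.isSome]
      simp only [Finset.mem_sdiff, mem_topLevel] at h1
      simp only [Finset.mem_sdiff, h1, mem_topLevel]
      simp
    · simp [h1]
  · intro c d hc
    obtain ⟨h1, h2⟩ := hsome c d hc
    have h3 := h.label c d h2
    simp only [Finset.mem_sdiff, mem_topLevel, mem_botLevel, mem_freeLevel] at *
    refine ⟨by omega, fun h4 => ?_⟩
    -- If `d` were below a ball of the same label, that ball would be paired with `d`. By
    -- injectivity it would be `c`, which is not over a free ball.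
    have h5 := h.triv d (by omega) (by omega) (by omega)
    have h6 := h.inj _ _ _ h2 h5
    subst h6
    omega
  · intro d hd
    simp only [Finset.mem_sdiff, mem_topLevel, mem_botLevel] at hd
    obtain ⟨b, hb⟩ := h.onto d (by omega)
    refine ⟨b, ?_⟩
    have hl := h.label _ _ hb
    rw [levelPart, if_pos, hb]
    simp only [Finset.mem_sdiff, mem_topLevel, mem_freeLevel]
    refine ⟨by omega, fun h1 => ?_⟩
    have h2 := h.triv b (by omega) h1.1 (by omega)
    rw [h2, Option.some.injEq] at hb
    subst hb
    omega
  · intro c₁ c₂ d h1 h2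
    exact h.inj _ _ _ (hsome _ _ h1).2 (hsome _ _ h2).2

theorem levelPart_assemble {L : ℕ} {μ ν : Fin n → ℕ} {x : Fin L → Fin n → Option (Fin n)}
    (hx : ∀ k : Fin L, x k ∈
      matchings (topLevel ν k \ freeLevel μ k) (botLevel μ k \ topLevel ν k)) (k : Fin L) :
    levelPart μ ν (assemble μ ν x) k = x k := by
  funext c
  unfold levelPart
  split_ifs with h
  · simp only [Finset.mem_sdiff, mem_topLevel, mem_freeLevel] at h
    have hk : ν c - 1 < L := by have := k.2; omega
    unfold assemble
    rw [dif_pos hk, if_neg (by omega), if_neg (by omega)]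
    congr 2
    omega
  · exact (eq_none_of_mem_matchings (hx k) h).symm

theorem assemble_levelPart {L : ℕ} {μ ν : Fin n → ℕ} (hν : ∀ c, ν c ≤ L)
    {σ : Fin n → Option (Fin n)} (h : IsRowMatching μ ν σ) :
    assemble μ ν (fun k : Fin L => levelPart μ ν σ k) = σ := by
  funext c
  unfold assemble
  have hnone : ν c = 0 → σ c = none := fun h0 => by
    rw [← Option.not_isSome_iff_eq_none, h.isSome]; simp [h0]
  have := hν c
  split_ifs with h1 h2 h3
  · exact (hnone h2).symm
  · exact (h.triv c h2 h3.1 h3.2).symm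
  · refine if_pos ?_
    simp only [Finset.mem_sdiff, mem_topLevel, mem_freeLevel]
    omega
  · exact (hnone (by omega)).symm

theorem isRowMatching_assemble {L : ℕ} {μ ν : Fin n → ℕ} (hμ : ∀ c, μ c ≤ L + 1)
    (hν : ∀ c, ν c ≤ L)
    (hT : ∀ k : Fin L, topLevel ν k ∩ freeLevel μ k ⊆ botLevel μ k)
    {x : Fin L → Fin n → Option (Fin n)}
    (hx : ∀ k : Fin L, x k ∈
      matchings (topLevel ν k \ freeLevel μ k) (botLevel μ k \ topLevel ν k)) :
    IsRowMatching μ ν (assemble μ ν x) := by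
  -- The inclusion for the label `ν c + 1`, which has index `ν c - 1`: trivial pairings respect the
  -- labels.
  have hT' : ∀ c, ν c ≠ 0 → μ c ≠ 0 → μ c ≤ ν c + 1 → μ c = ν c + 1 := by
    intro c h1 h2 h3
    have := hν c
    have h4 := @hT ⟨ν c - 1, by omega⟩ c (by
      simp only [Finset.mem_inter, mem_topLevel, mem_freeLevel]; omega)
    simp only [mem_botLevel] at h4
    omega
  have hA : ∀ c, ν c ≠ 0 → (μ c = 0 ∨ ν c + 1 < μ c) → ∃ k : Fin L, ν c = k + 1 ∧
      c ∈ topLevel ν k \ freeLevel μ k ∧ assemble μ ν x c = x k c := by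
    intro c h1 h2
    have := hν c
    refine ⟨⟨ν c - 1, by omega⟩, by simp only; omega, ?_, ?_⟩
    · simp only [Finset.mem_sdiff, mem_topLevel, mem_freeLevel]; omega
    · unfold assemble
      rw [dif_pos (by omega), if_neg h1, if_neg (by omega)]
  have hB : ∀ c, ν c ≠ 0 → μ c ≠ 0 → μ c ≤ ν c + 1 → assemble μ ν x c = some c := by
    intro c h1 h2 h3
    have := hν c
    unfold assemble
    rw [dif_pos (by omega), if_neg h1, if_pos ⟨h2, h3⟩]
  have hN : ∀ c, ν c = 0 → assemble μ ν x c = none := by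
    intro c h1
    unfold assemble
    split_ifs <;> rfl
  -- the two kinds of pairings
  have hcase : ∀ c d, assemble μ ν x c = some d → (ν c ≠ 0 ∧ μ c ≠ 0 ∧ μ c ≤ ν c + 1 ∧ d = c) ∨
      (∃ k : Fin L, ν c = k + 1 ∧ x k c = some d ∧ d ∈ botLevel μ k \ topLevel ν k) := by
    intro c d hc
    by_cases h0 : ν c = 0
    · rw [hN c h0] at hc; cases hc
    · by_cases h1 : μ c ≠ 0 ∧ μ c ≤ ν c + 1
      · rw [hB c h0 h1.1 h1.2, Option.some.injEq] at hc
        exact Or.inl ⟨h0, h1.1, h1.2, hc.symm⟩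
      · obtain ⟨k, hk, _, h2⟩ := hA c h0 (by omega)
        rw [h2] at hc
        exact Or.inr ⟨k, hk, hc, (mem_matchings.1 (hx k)).2.1 c d hc⟩
  refine ⟨?_, ?_, ?_, ?_, hB⟩
  · intro c
    by_cases h0 : ν c = 0
    · simp [hN c h0, h0]
    · by_cases h1 : μ c ≠ 0 ∧ μ c ≤ ν c + 1
      · simp [hB c h0 h1.1 h1.2, h0]
      · obtain ⟨k, hk, h3, h2⟩ := hA c h0 (by omega)
        rw [h2, (mem_matchings.1 (hx k)).1]
        simp only [h3, h0, ne_eq, not_false_eq_true]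
  · intro c d hc
    rcases hcase c d hc with ⟨h1, h2, h3, rfl⟩ | ⟨k, hk, _, hd⟩
    · exact hT' _ h1 h2 h3
    · simp only [Finset.mem_sdiff, mem_botLevel] at hd
      omega
  · intro c₁ c₂ d h1 h2
    rcases hcase c₁ d h1 with ⟨a1, a2, a3, rfl⟩ | ⟨k, hk, hxk, hd⟩
    · rcases hcase c₂ d h2 with ⟨b1, b2, b3, rfl⟩ | ⟨k, hk, hxk, hd⟩
      · rfl
      · simp only [Finset.mem_sdiff, mem_botLevel, mem_topLevel] at hd
        have := hT' d a1 a2 a3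
        omega
    · rcases hcase c₂ d h2 with ⟨b1, b2, b3, rfl⟩ | ⟨k', hk', hxk', hd'⟩
      · simp only [Finset.mem_sdiff, mem_botLevel, mem_topLevel] at hd
        have := hT' d b1 b2 b3
        omega
      · simp only [Finset.mem_sdiff, mem_botLevel] at hd hd'
        have : k = k' := by rw [Fin.ext_iff]; omega
        subst this
        exact (mem_matchings.1 (hx k)).2.2.2 _ _ _ hxk hxk'
  · intro d hd
    have := hμ d
    by_cases h1 : ν d + 1 = μ d
    · exact ⟨d, hB d (by omega) (by omega) (by omega)⟩
    · obtain ⟨c, hc⟩ := (mem_matchings.1 (hx ⟨μ d - 2, by omega⟩)).2.2.1 d (by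
        simp only [Finset.mem_sdiff, mem_botLevel, mem_topLevel]; omega)
      have h2 : c ∈ topLevel ν (μ d - 2) \ freeLevel μ (μ d - 2) :=
        ((mem_matchings.1 (hx ⟨μ d - 2, by omega⟩)).1 c).1 (by simp [hc])
      simp only [Finset.mem_sdiff, mem_topLevel, mem_freeLevel] at h2
      obtain ⟨k, hk, _, h3⟩ := hA c (by omega) (by omega)
      refine ⟨c, ?_⟩
      rw [h3, ← hc]
      congr 1
      rw [Fin.ext_iff]
      simp only
      omega

/-- When the nontrivial pairings of label `k + 2` begin, the larger labels and the trivial pairings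
of this label are already placed. The free balls are those of label at most `k + 2` that are not
under an upper ball of label `k + 2`. -/
theorem rowWt_eq_prod {L : ℕ} (q t : K) {μ ν : Fin n → ℕ} (hν : ∀ c, ν c ≤ L)
    {σ : Fin n → Option (Fin n)} (h : IsRowMatching μ ν σ) :
    rowWt q t μ ν σ = ∏ k : Fin L, matchingWt (q ^ ((k : ℕ) + 1)) t
      (topLevel ν k \ freeLevel μ k) (freeLevel μ k \ topLevel ν k) (levelPart μ ν σ k) := by
  unfold rowWt matchingWt
  have hbi : ({c | ν c ≠ 0 ∧ σ c ≠ some c} : Finset (Fin n)) =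
      Finset.univ.biUnion fun k : Fin L => topLevel ν k \ freeLevel μ k := by
    ext c
    simp only [Finset.mem_filter, Finset.mem_univ, true_and, Finset.mem_biUnion, Finset.mem_sdiff,
      mem_topLevel, mem_freeLevel]
    constructor
    · rintro ⟨h1, h2⟩
      have := hν c
      refine ⟨⟨ν c - 1, by omega⟩, by simp only; omega, fun h3 => h2 (h.triv c h1 h3.1 ?_)⟩
      have := h3.2
      simp only at this
      omega
    · rintro ⟨k, h1, h2⟩
      refine ⟨by omega, fun h3 => ?_⟩
      have := h.label _ _ h3
      omega
  rw [hbi, Finset.prod_biUnion]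
  · refine Finset.prod_congr rfl fun k _ => Finset.prod_congr rfl fun c hc => ?_
    have hσ : levelPart μ ν σ k c = σ c := if_pos hc
    simp only [Finset.mem_sdiff, mem_topLevel, mem_freeLevel] at hc
    rw [hσ, hc.1]
    congr 1
    ext d
    simp only [rowFree, Finset.mem_filter, Finset.mem_univ, true_and, Finset.mem_sdiff,
      mem_topLevel, mem_freeLevel]
    constructor
    · rintro ⟨h1, h2⟩
      refine ⟨⟨⟨h1, ?_⟩, ?_⟩, ?_⟩
      · by_contra hlt
        obtain ⟨b, hb⟩ := h.onto d (by omega)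
        have := h.label _ _ hb
        exact h2 b hb (Or.inl (by omega))
      · intro hd
        by_cases hle : μ d ≤ ν d + 1
        · have h3 := h.triv d (by omega) h1 hle
          exact h2 d h3 (Or.inr ⟨by omega, Or.inl h3⟩)
        · obtain ⟨b, hb⟩ := h.onto d (by omega)
          have := h.label _ _ hb
          exact h2 b hb (Or.inl (by omega))
      · intro b hb hcb
        unfold levelPart at hb
        split_ifs at hb with hbm
        simp only [Finset.mem_sdiff, mem_topLevel] at hbm
        exact h2 b hb (Or.inr ⟨by omega, Or.inr hcb⟩)
    · rintro ⟨⟨⟨h1, h2⟩, h3⟩, h4⟩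
      refine ⟨h1, fun b hb => ?_⟩
      have hl := h.label _ _ hb
      rintro (h5 | ⟨h5, h6⟩)
      · omega
      · by_cases h7 : σ b = some b
        · rw [h7, Option.some.injEq] at hb
          subst hb
          omega
        · refine h4 b ?_ (h6.resolve_left h7)
          unfold levelPart
          rw [if_pos, hb]
          simp only [Finset.mem_sdiff, mem_topLevel, mem_freeLevel]
          refine ⟨by omega, fun h8 => h7 (h.triv b (by omega) h8.1 (by omega))⟩
  · intro k _ k' _ hkk
    rw [Function.onFun, Finset.disjoint_left]
    intro c hc hc'
    simp only [Finset.mem_sdiff, mem_topLevel] at hc hc'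
    apply hkk
    rw [Fin.ext_iff]
    omega

-- A row matching amounts to independent choices of the nontrivial pairings of each label, so the
-- sum of products is a product of sums. If for some label an upper ball lies over a free ball that
-- is not a partner, there is no row matching and that factor of `rowCoeff` vanishes.
open Classical in
theorem sum_rowWt {L : ℕ} (q : K) {t : K} (ht : t ≠ 0) {μ ν : Fin n → ℕ} (hμ : ∀ c, μ c ≤ L + 1)
    (hν : ∀ c, ν c ≤ L) :
    ∑ σ with IsRowMatching μ ν σ, rowWt q t μ ν σ = rowCoeff q t L μ ν := by
  unfold rowCoeff
  by_cases hT : ∀ k : Fin L, topLevel ν k ∩ freeLevel μ k ⊆ botLevel μ k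
  · have : ∀ k : Fin L,
        levelWt (q ^ ((k : ℕ) + 1)) t (topLevel ν k) (freeLevel μ k) (botLevel μ k) =
        ∑ τ ∈ matchings (topLevel ν k \ freeLevel μ k) (botLevel μ k \ topLevel ν k),
          matchingWt (q ^ ((k : ℕ) + 1)) t
            (topLevel ν k \ freeLevel μ k) (freeLevel μ k \ topLevel ν k) τ := by
      intro k
      rw [levelWt, if_pos (hT k), sum_matchings ht _ _ (disjoint_sdiff_swap _ _)
        (Finset.sdiff_subset_sdiff (botLevel_subset _ _) le_rfl)]
    rw [Finset.prod_congr rfl fun k _ => this k, Finset.prod_univ_sum]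
    refine Finset.sum_bij' (fun σ _ k => levelPart μ ν σ k) (fun x _ => assemble μ ν x) ?_ ?_ ?_ ?_
      ?_
    · intro σ hσ
      rw [Fintype.mem_piFinset]
      exact fun k => levelPart_mem (by simpa using hσ) k
    · intro x hx
      rw [Fintype.mem_piFinset] at hx
      simpa using isRowMatching_assemble hμ hν hT hx
    · intro σ hσ
      exact assemble_levelPart hν (by simpa using hσ)
    · intro x hx
      rw [Fintype.mem_piFinset] at hx
      funext k
      exact levelPart_assemble hx k
    · intro σ hσ
      exact rowWt_eq_prod q t hν (by simpa using hσ)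
  · push Not at hT
    obtain ⟨k, hk⟩ := hT
    obtain ⟨c, hc, hcC⟩ := Finset.not_subset.1 hk
    rw [Finset.mem_inter] at hc
    rw [Finset.prod_eq_zero (Finset.mem_univ k) (levelWt_eq_zero _ _ hc.1 hc.2 hcC)]
    refine Finset.sum_eq_zero fun σ hσ => ?_
    exfalso
    have h : IsRowMatching μ ν σ := by simpa using hσ
    simp only [mem_topLevel, mem_freeLevel, mem_botLevel] at hc hcC
    have := h.label _ _ (h.triv c (by omega) hc.2.1 (by omega))
    omega

end Rows

/-! ### Removing and adding the bottom row. -/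

namespace MultilineQueue

variable {L n : ℕ}

theorem ext_ball_strand {Q Q' : MultilineQueue L n} (hb : Q.ball = Q'.ball)
    (hs : Q.strand = Q'.strand) : Q = Q' := by
  have hl := label_unique Q Q' hb hs
  obtain ⟨⟨b, _, _, _⟩, s, _, _, _, l, _, _, _, _⟩ := Q
  obtain ⟨⟨b', _, _, _⟩, s', _, _, _, l', _, _, _, _⟩ := Q'
  simp only at hb hs hl
  subst hb hs hl
  rfl

section Labels

variable (Q : MultilineQueue L n)

theorem ball_zero : Q.ball 0 = ∅ := Q.ball_eq_empty 0 (Or.inl rfl)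

theorem strand_le_one {r : ℕ} (hr : r ≤ 1) (c : Fin n) : Q.strand r c = none := by
  rw [← Option.not_isSome_iff_eq_none, Q.strand_isSome]
  omega

theorem mem_of_strand {r : ℕ} {c d : Fin n} (h : Q.strand r c = some d) : c ∈ Q.ball r :=
  ((Q.strand_isSome r c).1 (by simp [h])).2

theorem label_bounds {r : ℕ} {c : Fin n} (hc : c ∈ Q.ball r) :
    r ≤ Q.label r c ∧ Q.label r c ≤ L := by
  -- Downward induction on the row, starting above the top row.
  have key : ∀ k r, L < r + k → ∀ c ∈ Q.ball r, r ≤ Q.label r c ∧ Q.label r c ≤ L := by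
    intro k
    induction k with
    | zero =>
      intro r hr c hc
      rw [Q.ball_eq_empty r (Or.inr (by omega))] at hc
      simp at hc
    | succ k ih =>
      intro r hr c hc
      by_cases hm : ∃ b, Q.strand (r + 1) b = some c
      · obtain ⟨b, hb⟩ := hm
        have := ih (r + 1) (by omega) b (Q.mem_of_strand hb)
        rw [Q.label_strand r b c hb]
        omega
      · push Not at hm
        rw [Q.label_new r c hc hm]
        refine ⟨le_rfl, ?_⟩
        by_contra h
        rw [Q.ball_eq_empty r (Or.inr (by omega))] at hc
        simp at hc
  exact key (L + 1) r (by omega) c hc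

theorem label_le (r : ℕ) (c : Fin n) : Q.label r c ≤ L := by
  by_cases hc : c ∈ Q.ball r
  · exact (Q.label_bounds hc).2
  · rw [Q.label_empty r c hc]; exact Nat.zero_le _

theorem label_ne_zero {r : ℕ} {c : Fin n} : Q.label r c ≠ 0 ↔ c ∈ Q.ball r := by
  constructor
  · intro h
    by_contra hc
    exact h (Q.label_empty r c hc)
  · intro h
    have := (Q.label_bounds h).1
    have : r ≠ 0 := by rintro rfl; rw [Q.ball_zero] at h; simp at h
    omega

end Labels

/-- The multiline queue formed by the rows above the bottom row. -/
def tail (Q : MultilineQueue (L + 1) n) : MultilineQueue L n where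
  ball r := if r = 0 then ∅ else Q.ball (r + 1)
  ball_eq_empty r hr := by
    split_ifs with h
    · rfl
    · exact Q.ball_eq_empty _ (by omega)
  top_nonempty h := by
    rw [if_neg (by omega)]
    exact Q.top_nonempty (by omega)
  card_mono r h1 h2 := by
    rw [if_neg (by omega), if_neg (by omega)]
    exact Q.card_mono (r + 1) (by omega) (by omega)
  strand r c := if r ≤ 1 then none else Q.strand (r + 1) c
  strand_isSome r c := by
    split_ifs with h1 h2 h2
    · simp
    · simp; omega
    · omega
    · rw [Q.strand_isSome]
      exact and_congr_left fun _ => by omega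
  strand_mem r c d h := by
    split_ifs at h with h1
    rw [if_neg (by omega)]
    exact Q.strand_mem _ _ _ h
  strand_inj r c₁ c₂ d h₁ h₂ := by
    split_ifs at h₁ h₂
    exact Q.strand_inj _ _ _ _ h₁ h₂
  -- Truncated subtraction keeps the label `0` of empty positions.
  label r c := if r = 0 then 0 else Q.label (r + 1) c - 1
  label_empty r c h := by
    split_ifs at h ⊢
    · rfl
    · rw [Q.label_empty _ _ h]
  label_new r c hc h := by
    split_ifs at hc ⊢ with h0
    · simp at hc
    · rw [Q.label_new _ _ hc, Nat.add_sub_cancel]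
      intro b hb
      exact h b (by rw [if_neg (by omega)]; exact hb)
  label_strand r b c h := by
    split_ifs at h with h1
    rw [if_neg (by omega), if_neg (by omega), Q.label_strand _ _ _ h]
  trivial_pairing r c hr hc hc' h := by
    rw [if_neg (by omega)] at hc hc' ⊢
    refine Q.trivial_pairing _ _ (by omega) hc hc' ?_
    rintro ⟨b, hb, hlt⟩
    refine h ⟨b, ?_, ?_⟩
    · rw [if_neg (by omega)]; exact hb
    · rw [if_neg (by omega), if_neg (by omega)]
      have := (Q.label_bounds hc).1
      omega

section Tail

variable (Q : MultilineQueue (L + 1) n)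

theorem tail_ball {r : ℕ} (hr : r ≠ 0) : Q.tail.ball r = Q.ball (r + 1) := if_neg hr

theorem tail_strand {r : ℕ} (hr : 2 ≤ r) : Q.tail.strand r = Q.strand (r + 1) := by
  funext c
  exact if_neg (by omega)

theorem tail_label {r : ℕ} (hr : r ≠ 0) (c : Fin n) :
    Q.tail.label r c = Q.label (r + 1) c - 1 := if_neg hr

theorem tail_label_one (c : Fin n) : Q.tail.label 1 c = Q.label 2 c - 1 :=
  Q.tail_label one_ne_zero c

theorem isRowMatching_tail {μ : Fin n → ℕ} (h : Q.HasType μ) :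
    IsRowMatching μ (Q.tail.label 1) (Q.strand 2) where
  isSome c := by
    rw [Q.strand_isSome, label_ne_zero, tail_ball _ one_ne_zero]
    simp
  label c d hcd := by
    rw [← h d, Q.label_strand 1 c d hcd, tail_label_one, one_add_one_eq_two]
    have := (Q.label_bounds (Q.mem_of_strand hcd)).1
    omega
  inj := Q.strand_inj 2
  onto d hd := by
    by_contra hne
    push Not at hne
    have hb : d ∈ Q.ball 1 := Q.label_ne_zero.1 (by rw [h d]; omega)
    have := Q.label_new 1 d hb hne
    rw [h d] at this
    omega
  triv c h1 h2 h3 := by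
    have hc : c ∈ Q.ball 2 := by
      rw [label_ne_zero, tail_ball _ one_ne_zero] at h1
      exact h1
    rw [← h c, label_ne_zero] at h2
    refine Q.trivial_pairing 1 c le_rfl hc h2 ?_
    rintro ⟨b, hb, hlt⟩
    rw [← h c, Q.label_strand 1 b c hb, tail_label_one] at h3
    rw [one_add_one_eq_two] at hlt h3
    have := (Q.label_bounds hc).1
    omega

theorem colCount_tail {μ : Fin n → ℕ} (h : Q.HasType μ) (c : Fin n) :
    Q.colCount c = (if μ c ≠ 0 then 1 else 0) + Q.tail.colCount c := by
  unfold colCount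
  rw [← Finset.insert_Icc_add_one_left_eq_Icc (by omega : 1 ≤ L + 1),
    ← Finset.map_add_right_Icc 1 L 1, Finset.filter_insert, Finset.filter_map, ← h c]
  have hf : ({r ∈ Finset.Icc 1 L | ((fun r => c ∈ Q.ball r) ∘ (addRightEmbedding 1)) r} :
      Finset ℕ) = {r ∈ Finset.Icc 1 L | c ∈ Q.tail.ball r} := by
    refine Finset.filter_congr fun r hr => ?_
    rw [Finset.mem_Icc] at hr
    rw [tail_ball _ (by omega)]
    rfl
  rw [hf]
  simp only [label_ne_zero]
  split_ifs with h1
  · rw [Finset.card_insert_of_notMem (by simp), Finset.card_map, add_comm]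
  · rw [Finset.card_map, zero_add]

theorem wtx_tail (K : Type*) [Field K] {μ : Fin n → ℕ} (h : Q.HasType μ) :
    Q.wtx K = (∏ c with μ c ≠ 0, MvPolynomial.X c) * Q.tail.wtx K := by
  unfold wtx
  rw [Finset.prod_filter, ← Finset.prod_mul_distrib]
  refine Finset.prod_congr rfl fun c _ => ?_
  rw [colCount_tail Q h, pow_add]
  congr 1
  split_ifs <;> simp

variable {K : Type*} [Field K]

/-- Rows and labels drop by one together, so neither the exponent of `q` nor the order of placement
changes. -/
theorem pairingWt_tail (q t : K) {r : ℕ} (hr : 2 ≤ r) {c d : Fin n}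
    (hcd : Q.strand (r + 1) c = some d) :
    Q.pairingWt q t (r + 1) c d = Q.tail.pairingWt q t r c d := by
  have hc := (Q.label_bounds (Q.mem_of_strand hcd)).1
  have hl : Q.tail.label r c - r + 1 = Q.label (r + 1) c - (r + 1) + 1 := by
    rw [tail_label _ (by omega)]; omega
  have hp : ∀ b d, Q.strand (r + 1) b = some d →
      (Q.tail.PlacedBefore r b c ↔ Q.PlacedBefore (r + 1) b c) := by
    intro b d hb
    have hb' := (Q.label_bounds (Q.mem_of_strand hb)).1
    unfold PlacedBefore
    rw [tail_label _ (by omega), tail_label _ (by omega), tail_strand _ hr]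
    have e1 : Q.label (r + 1) c - 1 < Q.label (r + 1) b - 1 ↔
      Q.label (r + 1) c < Q.label (r + 1) b := by omega
    have e2 : Q.label (r + 1) b - 1 = Q.label (r + 1) c - 1 ↔
      Q.label (r + 1) b = Q.label (r + 1) c := by omega
    rw [e1, e2]
  have hf : Q.tail.freeBalls r c = Q.freeBalls (r + 1) c := by
    unfold freeBalls
    rw [tail_ball _ (by omega), tail_strand _ hr, show r - 1 + 1 = r + 1 - 1 by omega]
    refine Finset.filter_congr fun d _ => forall_congr' fun b => ?_
    constructor
    · intro h hb
      rw [← hp b d hb]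
      exact h hb
    · intro h hb
      rw [hp b d hb]
      exact h hb
  unfold pairingWt skippedBalls
  rw [hl, hf]

theorem prod_row_two (q t : K) {μ : Fin n → ℕ} (h : Q.HasType μ) :
    ∏ p ∈ Q.nontrivialPairings 2, Q.pairingWt q t 2 p.1 p.2 =
      rowWt q t μ (Q.tail.label 1) (Q.strand 2) := by
  have hm := Q.isRowMatching_tail h
  unfold rowWt
  refine Finset.prod_bij (fun p _ => p.1) ?_ ?_ ?_ ?_
  · rintro ⟨c, d⟩ hp
    simp only [nontrivialPairings, Finset.mem_filter, Finset.mem_univ, true_and] at hp ⊢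
    refine ⟨(hm.isSome c).1 (by simp [hp.1]), fun h' => hp.2 ?_⟩
    rw [hp.1, Option.some.injEq] at h'
    exact h'
  · rintro ⟨c, d⟩ hp ⟨c', d'⟩ hp' he
    simp only [nontrivialPairings, Finset.mem_filter, Finset.mem_univ, true_and] at hp hp' he
    subst he
    rw [hp.1, Option.some.injEq] at hp'
    rw [hp'.1]
  · intro c hc
    simp only [Finset.mem_filter, Finset.mem_univ, true_and] at hc
    obtain ⟨d, hd⟩ := Option.isSome_iff_exists.1 ((hm.isSome c).2 hc.1)
    refine ⟨(c, d), ?_, rfl⟩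
    simp only [nontrivialPairings, Finset.mem_filter, Finset.mem_univ, true_and]
    exact ⟨hd, fun h' => hc.2 (by rw [hd, h'])⟩
  · rintro ⟨c, d⟩ hp
    simp only [nontrivialPairings, Finset.mem_filter, Finset.mem_univ, true_and] at hp ⊢
    have hb := Q.mem_of_strand hp.1
    have hc := (Q.label_bounds hb).1
    have hl : Q.label 2 c - 2 + 1 = Q.tail.label 1 c := by
      rw [tail_label_one]; omega
    have hf : Q.freeBalls 2 c = rowFree μ (Q.tail.label 1) (Q.strand 2) c := by
      ext e
      simp only [freeBalls, rowFree, Finset.mem_filter, Finset.mem_univ, true_and, ← h e,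
        label_ne_zero]
      refine and_congr_right fun _ => forall_congr' fun b => ?_
      refine ⟨fun h hb => ?_, fun h hb => ?_⟩
      all_goals
        have hb' := (Q.label_bounds (Q.mem_of_strand hb)).1
        have h1 := h hb
        contrapose! h1
        unfold PlacedBefore at *
        simp only [tail_label_one] at *
        refine h1.imp (fun h => by omega) (And.imp_left fun h => by omega)
    rw [hp.1, Option.getD_some, ← hf, ← hl]
    rfl

theorem wtqt_tail (q t : K) {μ : Fin n → ℕ} (h : Q.HasType μ) :
    Q.wtqt q t = rowWt q t μ (Q.tail.label 1) (Q.strand 2) * Q.tail.wtqt q t := by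
  rw [← Q.prod_row_two q t h]
  unfold wtqt
  rcases Nat.eq_zero_or_pos L with rfl | hL
  · have : Q.nontrivialPairings 2 = ∅ := by
      refine Finset.filter_eq_empty_iff.2 ?_
      rintro ⟨c, d⟩ _ ⟨h1, _⟩
      have := Q.mem_of_strand h1
      rw [Q.ball_eq_empty 2 (Or.inr (by omega))] at this
      simp at this
    rw [this]
    simp
  · rw [← Finset.insert_Icc_add_one_left_eq_Icc (by omega : 2 ≤ L + 1),
      ← Finset.map_add_right_Icc 2 L 1, Finset.prod_insert (by simp), Finset.prod_map]
    congr 1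
    refine Finset.prod_congr rfl fun r hr => ?_
    rw [Finset.mem_Icc] at hr
    have hn : Q.tail.nontrivialPairings r = Q.nontrivialPairings (r + 1) := by
      unfold nontrivialPairings
      rw [tail_strand _ hr.1]
    rw [hn]
    refine Finset.prod_congr rfl fun p hp => ?_
    simp only [nontrivialPairings, Finset.mem_filter] at hp
    exact Q.pairingWt_tail q t hr.1 hp.2.1

theorem wt_tail (q t : K) {μ : Fin n → ℕ} (h : Q.HasType μ) :
    Q.wt q t = (∏ c with μ c ≠ 0, MvPolynomial.X c) *
      (MvPolynomial.C (rowWt q t μ (Q.tail.label 1) (Q.strand 2)) * Q.tail.wt q t) := by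
  unfold wt
  rw [Q.wtx_tail K h, Q.wtqt_tail q t h, map_mul]
  ring

end Tail

section Cons

variable (Q : MultilineQueue L n)

/-- Adding a new bottom row with labels `μ`. -/
def cons (μ : Fin n → ℕ) (σ : Fin n → Option (Fin n)) (h : IsRowMatching μ (Q.label 1) σ)
    (hμ : ∃ c, μ c ≠ 0) : MultilineQueue (L + 1) n where
  ball r := match r with
    | 0 => ∅
    | 1 => {c | μ c ≠ 0}
    | r + 2 => Q.ball (r + 1)
  ball_eq_empty r hr := by
    match r with
    | 0 => rfl
    | 1 => omega
    | r + 2 => exact Q.ball_eq_empty _ (Or.inr (by omega))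
  top_nonempty _ := by
    match L with
    -- Here the new row is itself the top row and must not be empty.
    | 0 =>
      obtain ⟨c, hc⟩ := hμ
      exact ⟨c, by simp [hc]⟩
    | L + 1 => exact Q.top_nonempty (by omega)
  card_mono r h1 h2 := by
    match r with
    | 0 => omega
    | 1 =>
      have hmem : ∀ c ∈ Q.ball 1, ∃ d, σ c = some d := fun c hc =>
        Option.isSome_iff_exists.1 ((h.isSome c).2 (Q.label_ne_zero.2 hc))
      refine Finset.card_le_card_of_injOn (fun c => (σ c).getD c) ?_ ?_
      · intro c hc
        obtain ⟨d, hd⟩ := hmem c hc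
        have := h.label c d hd
        simp only [hd, Option.getD_some, ne_eq, Finset.coe_filter, Finset.mem_univ, true_and,
          Set.mem_ofPred_eq]
        omega
      · intro c hc c' hc' he
        obtain ⟨d, hd⟩ := hmem c hc
        obtain ⟨d', hd'⟩ := hmem c' hc'
        simp only [hd, hd', Option.getD_some] at he
        subst he
        exact h.inj _ _ _ hd hd'
    | r + 2 => exact Q.card_mono (r + 1) (by omega) (by omega)
  strand r c := match r with
    | 0 => none
    | 1 => none
    | 2 => σ c
    | r + 3 => Q.strand (r + 2) c
  strand_isSome r c := by
    match r with
    | 0 => simp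
    | 1 => simp
    | 2 => simpa [Q.label_ne_zero] using h.isSome c
    | r + 3 =>
      have := Q.strand_isSome (r + 2) c
      simpa using this
  strand_mem r c d hcd := by
    match r with
    | 0 => simp at hcd
    | 1 =>
      have := h.label c d hcd
      simp only [ne_eq, Finset.mem_filter, Finset.mem_univ, true_and]
      omega
    | r + 2 => exact Q.strand_mem (r + 1) c d hcd
  strand_inj r c₁ c₂ d h₁ h₂ := by
    match r with
    | 0 => simp at h₁
    | 1 => simp at h₁
    | 2 => exact h.inj _ _ _ h₁ h₂
    | r + 3 => exact Q.strand_inj _ _ _ _ h₁ h₂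
  label r c := match r with
    | 0 => 0
    | 1 => μ c
    | r + 2 => if c ∈ Q.ball (r + 1) then Q.label (r + 1) c + 1 else 0
  label_empty r c hc := by
    match r with
    | 0 => rfl
    | 1 => simpa using hc
    | r + 2 => exact if_neg hc
  label_new r c hc hb := by
    match r with
    | 0 => simp at hc
    | 1 =>
      have hc' : μ c ≠ 0 := by simpa using hc
      by_contra h1
      obtain ⟨b, hb'⟩ := h.onto c (by change ¬ μ c = 1 at h1; omega)
      exact hb b hb'
    | r + 2 =>
      refine (if_pos hc).trans ?_
      rw [Q.label_new (r + 1) c hc hb]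
  label_strand r b c hbc := by
    match r with
    | 0 => simp at hbc
    | 1 =>
      have hb : b ∈ Q.ball 1 := Q.label_ne_zero.1 ((h.isSome b).1 (by
        change σ b = some c at hbc; simp [hbc]))
      exact (h.label b c hbc).trans (if_pos hb).symm
    | r + 2 =>
      have hb : b ∈ Q.ball (r + 2) := Q.mem_of_strand hbc
      refine (if_pos (Q.strand_mem _ _ _ hbc)).trans (Eq.trans ?_ (if_pos hb).symm)
      rw [Q.label_strand _ _ _ hbc]
  trivial_pairing r c hr hc hc' hb := by
    match r with
    | 0 => omega
    | 1 =>
      have hc1 : c ∈ Q.ball 1 := hc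
      have hc2 : μ c ≠ 0 := by simpa using hc'
      refine h.triv c (Q.label_ne_zero.2 hc1) hc2 ?_
      by_contra hlt
      obtain ⟨b, hb'⟩ := h.onto c (by omega)
      have hb1 : b ∈ Q.ball 1 := Q.label_ne_zero.1 ((h.isSome b).1 (by simp [hb']))
      have := h.label _ _ hb'
      refine hb ⟨b, hb', ?_⟩
      simp only [hc1, hb1, if_true, zero_add]
      omega
    | r + 2 =>
      refine Q.trivial_pairing (r + 1) c (by omega) hc hc' ?_
      rintro ⟨b, hb', hlt⟩
      refine hb ⟨b, hb', ?_⟩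
      have hc1 : c ∈ Q.ball (r + 1 + 1) := hc
      have hb1 : b ∈ Q.ball (r + 1 + 1) := Q.mem_of_strand hb'
      simp only [hc1, hb1, if_true]
      omega

variable {Q} {μ : Fin n → ℕ} {σ : Fin n → Option (Fin n)} {h : IsRowMatching μ (Q.label 1) σ}
  {hμ : ∃ c, μ c ≠ 0}

theorem cons_hasType : (Q.cons μ σ h hμ).HasType μ := fun _ => rfl

theorem cons_strand_two : (Q.cons μ σ h hμ).strand 2 = σ := rfl

theorem tail_cons : (Q.cons μ σ h hμ).tail = Q := by
  refine ext_ball_strand ?_ ?_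
  · funext r
    match r with
    | 0 => rw [ball_zero, ball_zero]
    | r + 1 => rfl
  · funext r
    match r with
    | 0 => funext c; rw [strand_le_one _ (by omega), strand_le_one _ (by omega)]
    | 1 => funext c; rw [strand_le_one _ (by omega), strand_le_one _ (by omega)]
    | r + 2 => rfl

theorem eq_of_tail_eq {Q Q' : MultilineQueue (L + 1) n} {μ : Fin n → ℕ} (h : Q.HasType μ)
    (h' : Q'.HasType μ) (ht : Q.tail = Q'.tail) (hs : Q.strand 2 = Q'.strand 2) : Q = Q' := by
  refine ext_ball_strand ?_ ?_
  · funext r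
    match r with
    | 0 => rw [ball_zero, ball_zero]
    | 1 =>
      ext c
      rw [← label_ne_zero, ← label_ne_zero, h c, h' c]
    | r + 2 => rw [← tail_ball Q r.succ_ne_zero, ht, tail_ball Q' r.succ_ne_zero]
  · funext r
    match r with
    | 0 => funext c; rw [strand_le_one _ (by omega), strand_le_one _ (by omega)]
    | 1 => funext c; rw [strand_le_one _ (by omega), strand_le_one _ (by omega)]
    | 2 => exact hs
    | r + 3 => rw [← tail_strand Q (by omega : 2 ≤ r + 2), ht, tail_strand Q' (by omega)]

end Cons

end MultilineQueue

/-! ### The recursion on the number of rows. -/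

section Recursion

variable {K : Type*} [Field K] {n : ℕ}

/-- The generating polynomial of the multiline queues of type `μ` with `L` rows. -/
noncomputable def rowsPoly (q t : K) (L : ℕ) (μ : Fin n → ℕ) : MvPolynomial (Fin n) K :=
  ∑ Q : MultilineQueue L n with Q.HasType μ, Q.wt q t

-- Multiline queues of type `μ` correspond to pairs of a multiline queue with `L` rows and a row
-- matching, by `tail` and `cons`. Weights multiply (`wt_tail`), and `sum_rowWt` carries out the sum
-- over the row matchings.
open Classical in
theorem rowsPoly_succ (q : K) {t : K} (ht : t ≠ 0) {L : ℕ} {μ : Fin n → ℕ} (hμ : ∃ c, μ c ≠ 0)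
    (hL : ∀ c, μ c ≤ L + 1) :
    rowsPoly q t (L + 1) μ = (∏ c with μ c ≠ 0, MvPolynomial.X c) *
      ∑ ν ∈ Fintype.piFinset fun _ : Fin n => Finset.range (L + 1),
        MvPolynomial.C (rowCoeff q t L μ ν) * rowsPoly q t L ν := by
  have hr : ∑ ν ∈ Fintype.piFinset fun _ : Fin n => Finset.range (L + 1),
        MvPolynomial.C (rowCoeff q t L μ ν) * rowsPoly q t L ν =
      ∑ Q : MultilineQueue L n, MvPolynomial.C (rowCoeff q t L μ (Q.label 1)) * Q.wt q t := by
    have hmaps : ∀ Q ∈ (Finset.univ : Finset (MultilineQueue L n)), Q.label 1 ∈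
        Fintype.piFinset fun _ : Fin n => Finset.range (L + 1) := by
      intro Q _
      rw [Fintype.mem_piFinset]
      exact fun c => Finset.mem_range.2 (Nat.lt_succ_of_le (Q.label_le 1 c))
    rw [← Finset.sum_fiberwise_of_maps_to hmaps]
    refine Finset.sum_congr rfl fun ν _ => ?_
    unfold rowsPoly
    rw [Finset.mul_sum]
    refine Finset.sum_congr ?_ fun Q hQ => ?_
    · refine Finset.filter_congr fun Q _ => ?_
      rw [MultilineQueue.HasType, funext_iff]
    · rw [(Finset.mem_filter.1 hQ).2]
  rw [hr]
  have hs : ∀ Q : MultilineQueue L n, MvPolynomial.C (rowCoeff q t L μ (Q.label 1)) * Q.wt q t =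
      ∑ σ with IsRowMatching μ (Q.label 1) σ,
        MvPolynomial.C (rowWt q t μ (Q.label 1) σ) * Q.wt q t := by
    intro Q
    rw [← sum_rowWt q ht hL (Q.label_le 1), map_sum, Finset.sum_mul]
  rw [Finset.sum_congr rfl fun Q _ => hs Q, Finset.sum_sigma', Finset.mul_sum]
  unfold rowsPoly
  refine Finset.sum_bij (fun Q _ => ⟨Q.tail, Q.strand 2⟩) ?_ ?_ ?_ ?_
  · intro Q hQ
    simp only [Finset.mem_sigma, Finset.mem_univ, true_and, Finset.mem_filter] at hQ ⊢
    exact Q.isRowMatching_tail hQ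
  · intro Q hQ Q' hQ' he
    simp only [Finset.mem_univ, true_and, Finset.mem_filter] at hQ hQ'
    simp only [Sigma.mk.injEq, heq_eq_eq] at he
    exact MultilineQueue.eq_of_tail_eq hQ hQ' he.1 he.2
  · rintro ⟨Q, σ⟩ h
    simp only [Finset.mem_sigma, Finset.mem_univ, true_and, Finset.mem_filter] at h
    refine ⟨Q.cons μ σ h hμ, ?_, ?_⟩
    · simp only [Finset.mem_univ, true_and, Finset.mem_filter]
      exact MultilineQueue.cons_hasType
    · rw [MultilineQueue.tail_cons, MultilineQueue.cons_strand_two]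
  · intro Q hQ
    simp only [Finset.mem_univ, true_and, Finset.mem_filter] at hQ
    exact Q.wt_tail q t hQ

end Recursion

/-! ### Exchange, rotation and degree relations for the coefficients R(μ, ν). -/

section RowCoefficients

variable {K : Type*} [Field K] {n : ℕ}

/-- The contribution of the label `k + 2` to `rowCoeff`. -/
noncomputable def rowLevel (q t : K) (μ ν : Fin n → ℕ) (k : ℕ) : K :=
  levelWt (q ^ (k + 1)) t (topLevel ν k) (freeLevel μ k) (botLevel μ k)

/-- The upper ball at `x` has label `ν x + 1 > μ x`, so the ball below it is still free. The forced
trivial pairing would give `μ x = ν x + 1`. -/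
theorem rowCoeff_eq_zero (q t : K) {L : ℕ} {μ ν : Fin n → ℕ} (x : Fin n) (hx : ν x ≤ L)
    (h₀ : μ x ≠ 0) (h : μ x ≤ ν x) : rowCoeff q t L μ ν = 0 := by
  refine Finset.prod_eq_zero (i := (⟨ν x - 1, by omega⟩ : Fin L)) (Finset.mem_univ _) ?_
  apply levelWt_eq_zero _ _ (x := x)
  · simp only [mem_topLevel]; omega
  · simp only [mem_freeLevel]; omega
  · simp only [mem_botLevel]; omega

section Swap

variable {i j : Fin n}

theorem topLevel_swap (ν : Fin n → ℕ) (k : ℕ) :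
    topLevel (ν ∘ Equiv.swap i j) k = swapSet i j (topLevel ν k) := by
  ext x; simp

theorem botLevel_swap (μ : Fin n → ℕ) (k : ℕ) :
    botLevel (μ ∘ Equiv.swap i j) k = swapSet i j (botLevel μ k) := by
  ext x; simp

theorem freeLevel_swap (μ : Fin n → ℕ) (k : ℕ) :
    freeLevel (μ ∘ Equiv.swap i j) k = swapSet i j (freeLevel μ k) := by
  ext x; simp

theorem comp_swap_swap (μ : Fin n → ℕ) : (μ ∘ Equiv.swap i j) ∘ Equiv.swap i j = μ := by
  funext x; simp

/-- The configurations at two adjacent columns whose exchange does not change the weight. -/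
def Inert (μ ν : Fin n → ℕ) (i j : Fin n) (k : ℕ) : Prop :=
  ¬ (ν i = k + 1 ∧ ¬ (μ i ≠ 0 ∧ μ i ≤ k + 2) ∧ (μ j ≠ 0 ∧ μ j ≤ k + 2) ∧ ν j ≠ k + 1) ∧
  ¬ (ν j = k + 1 ∧ ¬ (μ j ≠ 0 ∧ μ j ≤ k + 2) ∧ (μ i ≠ 0 ∧ μ i ≤ k + 2) ∧ ν i ≠ k + 1) ∧
  ((μ i ≠ 0 ∧ μ i ≤ k + 2) → (μ j ≠ 0 ∧ μ j ≤ k + 2) → ν i ≠ k + 1 → ν j ≠ k + 1 →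
    (μ i = k + 2 ↔ μ j = k + 2))

variable {q t : K} {μ ν : Fin n → ℕ} {k : ℕ}

theorem rowLevel_swap (ht : t ≠ 0) (hij : (j : ℕ) = i + 1) (h : Inert μ ν i j k) :
    rowLevel q t (μ ∘ Equiv.swap i j) (ν ∘ Equiv.swap i j) k = rowLevel q t μ ν k := by
  unfold rowLevel
  rw [topLevel_swap, freeLevel_swap, botLevel_swap]
  apply levelWt_swap ht _ hij (botLevel_subset μ k)
  · simpa only [mem_topLevel, mem_freeLevel] using h.1
  · simpa only [mem_topLevel, mem_freeLevel] using h.2.1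
  · simpa only [mem_topLevel, mem_freeLevel, mem_botLevel] using h.2.2

theorem rowLevel_swap_top_bottom (ht : t ≠ 0) (hij : (j : ℕ) = i + 1) (h₁ : ν i = k + 1)
    (h₂ : ¬ (μ i ≠ 0 ∧ μ i ≤ k + 2)) (h₃ : μ j ≠ 0 ∧ μ j < k + 2) (h₄ : ν j ≠ k + 1) :
    rowLevel q t μ ν k = t * rowLevel q t (μ ∘ Equiv.swap i j) (ν ∘ Equiv.swap i j) k := by
  unfold rowLevel
  rw [topLevel_swap, freeLevel_swap, botLevel_swap]
  apply levelWt_top_bottom ht _ hij (botLevel_subset μ k) <;>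
    simp only [mem_topLevel, mem_freeLevel, mem_botLevel] <;> omega

theorem rowLevel_swap_bottom_target (ht : t ≠ 0) (hij : (j : ℕ) = i + 1) (h₁ : ν i ≠ k + 1)
    (h₂ : ν j ≠ k + 1) (h₃ : μ i ≠ 0 ∧ μ i < k + 2) (h₄ : μ j = k + 2) :
    rowLevel q t μ ν k = t * rowLevel q t (μ ∘ Equiv.swap i j) (ν ∘ Equiv.swap i j) k := by
  unfold rowLevel
  rw [topLevel_swap, freeLevel_swap, botLevel_swap]
  apply levelWt_bottom_target ht _ hij (botLevel_subset μ k) <;>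
    simp only [mem_topLevel, mem_freeLevel, mem_botLevel] <;> omega

theorem rowLevel_swap_top_target (ht : t ≠ 0) (hq : ∀ a b : ℕ, 1 - q ^ (a + 1) * t ^ b ≠ 0)
    (hij : (j : ℕ) = i + 1) (h₁ : ν i = k + 1) (h₂ : ¬ (μ i ≠ 0 ∧ μ i ≤ k + 2))
    (h₃ : μ j = k + 2) (h₄ : ν j ≠ k + 1) :
    rowLevel q t μ ν k = t * rowLevel q t (μ ∘ Equiv.swap i j) (ν ∘ Equiv.swap i j) k +
      (1 - t) * rowLevel q t μ (ν ∘ Equiv.swap i j) k := by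
  unfold rowLevel
  rw [topLevel_swap, freeLevel_swap, botLevel_swap]
  apply levelWt_top_target ht _ (hq k) hij (botLevel_subset μ k) <;>
    simp only [mem_topLevel, mem_freeLevel, mem_botLevel] <;> omega

theorem rowLevel_swap_top (h : ν i = k + 1 ↔ ν j = k + 1) :
    rowLevel q t μ (ν ∘ Equiv.swap i j) k = rowLevel q t μ ν k := by
  unfold rowLevel
  rw [topLevel_swap, swapSet_eq_self (by simpa using h)]

/-- The lower row looks the same in both columns, so exchanging only the upper row amounts to
exchanging both rows, and the configuration is inert. -/
theorem rowLevel_swap_top' (ht : t ≠ 0) (hij : (j : ℕ) = i + 1)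
    (h₁ : (μ i ≠ 0 ∧ μ i ≤ k + 2) ↔ (μ j ≠ 0 ∧ μ j ≤ k + 2)) (h₂ : μ i = k + 2 ↔ μ j = k + 2) :
    rowLevel q t μ (ν ∘ Equiv.swap i j) k = rowLevel q t μ ν k := by
  have h : Inert μ ν i j k := ⟨by tauto, by tauto, by tauto⟩
  rw [← rowLevel_swap ht hij h]
  unfold rowLevel
  rw [freeLevel_swap, botLevel_swap, swapSet_eq_self (S := freeLevel μ k)
    (by simpa only [mem_freeLevel] using h₁), swapSet_eq_self (S := botLevel μ k)
    (by simpa only [mem_botLevel] using h₂)]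

theorem rowCoeff_eq_prod (q t : K) (L : ℕ) (μ ν : Fin n → ℕ) :
    rowCoeff q t L μ ν = ∏ k : Fin L, rowLevel q t μ ν k := rfl

theorem mul_prod_eq_mul_prod {ι : Type*} [Fintype ι] [DecidableEq ι] {f g : ι → K} {t : K} (a b : ι)
    (h : ∀ k, (if k = a then t else 1) * f k = (if k = b then t else 1) * g k) :
    t * ∏ k, f k = t * ∏ k, g k := by
  have := Finset.prod_congr (rfl : (Finset.univ : Finset ι) = Finset.univ) fun k _ => h k
  rw [Finset.prod_mul_distrib, Finset.prod_mul_distrib, Finset.prod_ite_eq',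
    Finset.prod_ite_eq', if_pos (Finset.mem_univ _), if_pos (Finset.mem_univ _)] at this
  exact this

theorem prod_eq_mul_prod {ι : Type*} [Fintype ι] [DecidableEq ι] {f g : ι → K} {t : K} (a : ι)
    (h : f a = t * g a) (h' : ∀ k, k ≠ a → f k = g k) : ∏ k, f k = t * ∏ k, g k := by
  rw [← Finset.mul_prod_erase _ f (Finset.mem_univ a),
    ← Finset.mul_prod_erase _ g (Finset.mem_univ a), h, mul_assoc]
  congr 2
  exact Finset.prod_congr rfl fun k hk => h' k (Finset.ne_of_mem_erase hk)

variable {L : ℕ}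

/-- Unless both sides vanish, `ν i ≤ ν j < μ j < μ i`. Then only the label `μ i` is affected: the
exchange puts its partner to the right of a free ball that is not a partner, which costs `t`. -/
theorem rowCoeff_swap_of_le (ht : t ≠ 0) (hij : (j : ℕ) = i + 1) (h₀ : μ j ≠ 0) (h₁ : μ j < μ i)
    (h₂ : μ i ≤ L + 1) (h₃ : ν i ≤ ν j) (h₄ : ν j ≤ L) :
    rowCoeff q t L (μ ∘ Equiv.swap i j) (ν ∘ Equiv.swap i j) = t * rowCoeff q t L μ ν := by
  by_cases hc : μ j ≤ ν j
  · rw [rowCoeff_eq_zero q t j h₄ h₀ hc, rowCoeff_eq_zero q t i, mul_zero] <;> simp <;> omega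
  · refine prod_eq_mul_prod (⟨μ i - 2, by omega⟩ : Fin L) ?_ fun k hk => ?_
    · have := rowLevel_swap_bottom_target (q := q) ht hij (μ := μ ∘ Equiv.swap i j)
        (ν := ν ∘ Equiv.swap i j) (k := μ i - 2) (by simp; omega) (by simp; omega)
        (by simp; omega) (by simp; omega)
      rwa [comp_swap_swap, comp_swap_swap] at this
    · have hk' : (k : ℕ) ≠ μ i - 2 := fun h => hk (Fin.ext h)
      exact rowLevel_swap ht hij ⟨by omega, by omega, by omega⟩

/-- The label `μ i` contributes `t` unless its ball at `i` is paired trivially. The label `ν i + 1`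
of the larger upper ball matters according to the size of `ν i` relative to `μ j`, and this decides
between one and two terms. -/
theorem rowCoeff_swap_of_gt (ht : t ≠ 0) (hq : ∀ a b : ℕ, 1 - q ^ (a + 1) * t ^ b ≠ 0)
    (hij : (j : ℕ) = i + 1) (h₀ : μ j ≠ 0) (h₁ : μ j < μ i)
    (h₂ : μ i ≤ L + 1) (h₃ : ν j < ν i) (h₄ : ν i ≤ L) :
    rowCoeff q t L (μ ∘ Equiv.swap i j) (ν ∘ Equiv.swap i j) =
      rowCoeff q t L μ ν + (t - 1) * rowCoeff q t L μ (ν ∘ Equiv.swap i j) := by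
  by_cases hci : μ i ≤ ν i
  · rw [rowCoeff_eq_zero q t i h₄ (by omega) hci, rowCoeff_eq_zero q t j,
      rowCoeff_eq_zero q t j, mul_zero, add_zero] <;> simp <;> omega
  by_cases hcj : μ j ≤ ν j
  · rw [rowCoeff_eq_zero q t j (by omega) h₀ hcj, rowCoeff_eq_zero q t i,
      rowCoeff_eq_zero q t j, mul_zero, add_zero] <;> simp <;> omega
  -- the level of the larger part
  have ha : ν i ≠ μ i - 1 → rowLevel q t (μ ∘ Equiv.swap i j) (ν ∘ Equiv.swap i j) (μ i - 2) =
      t * rowLevel q t μ ν (μ i - 2) := by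
    intro hne
    have := rowLevel_swap_bottom_target (q := q) ht hij (μ := μ ∘ Equiv.swap i j)
      (ν := ν ∘ Equiv.swap i j) (k := μ i - 2) (by simp; omega) (by simp; omega)
      (by simp; omega) (by simp; omega)
    rwa [comp_swap_swap, comp_swap_swap] at this
  by_cases hc : μ j ≤ ν i
  · rw [rowCoeff_eq_zero q t (ν := ν ∘ Equiv.swap i j) j (by simpa using h₄) h₀ (by simpa using hc),
      mul_zero, add_zero]
    by_cases he : ν i = μ i - 1
    · refine Finset.prod_congr rfl fun k _ => ?_
      exact rowLevel_swap ht hij ⟨by omega, by omega, by omega⟩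
    -- The exchange loses a factor `t` at the label `ν i + 1`, whose ball no longer skips its
    -- neighbour, and gains one at the label `μ i`.
    · refine mul_left_cancel₀ ht (mul_prod_eq_mul_prod (⟨ν i - 1, by omega⟩ : Fin L)
        (⟨μ i - 2, by omega⟩ : Fin L) fun k => ?_)
      simp only [Fin.ext_iff]
      by_cases hk1 : (k : ℕ) = ν i - 1
      · rw [if_pos hk1, if_neg (by omega), one_mul]
        exact (rowLevel_swap_top_bottom ht hij (by omega) (by omega) (by omega) (by omega)).symm
      · by_cases hk2 : (k : ℕ) = μ i - 2
        · rw [if_neg hk1, if_pos hk2, one_mul, hk2]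
          exact ha he
        · rw [if_neg hk1, if_neg hk2]
          congr 1
          exact rowLevel_swap ht hij ⟨by omega, by omega, by omega⟩
  have ha' := ha (by omega)
  have hother : ∀ k : ℕ, k ≠ μ i - 2 → k ≠ ν i - 1 →
      rowLevel q t (μ ∘ Equiv.swap i j) (ν ∘ Equiv.swap i j) k = rowLevel q t μ ν k ∧
      rowLevel q t μ (ν ∘ Equiv.swap i j) k = rowLevel q t μ ν k := by
    intro k hk1 hk2
    refine ⟨rowLevel_swap ht hij ⟨by omega, by omega, by omega⟩, ?_⟩
    by_cases hk3 : ν j = k + 1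
    · exact rowLevel_swap_top' ht hij (by omega) (by omega)
    · exact rowLevel_swap_top (by omega)
  have ha2 : rowLevel q t μ (ν ∘ Equiv.swap i j) (μ i - 2) = rowLevel q t μ ν (μ i - 2) :=
    rowLevel_swap_top (by omega)
  by_cases he : ν i = μ j - 1
  -- The upper ball at `i` and the lower ball at `j` have the same label: the case with two terms.
  · have hb := rowLevel_swap_top_target ht hq hij (ν := ν) (μ := μ) (k := ν i - 1) (by omega)
      (by omega) (by omega) (by omega)
    have hmem : (⟨ν i - 1, by omega⟩ : Fin L) ∈ Finset.univ.erase (⟨μ i - 2, by omega⟩ : Fin L) := by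
      simp only [Finset.mem_erase, Finset.mem_univ, and_true, ne_eq, Fin.ext_iff]
      omega
    have hsplit : ∀ f : ℕ → K, ∏ k : Fin L, f k = f (μ i - 2) * (f (ν i - 1) *
        ∏ k ∈ (Finset.univ.erase (⟨μ i - 2, by omega⟩ : Fin L)).erase ⟨ν i - 1, by omega⟩,
          f k) := by
      intro f
      rw [← Finset.mul_prod_erase _ _ (Finset.mem_univ (⟨μ i - 2, by omega⟩ : Fin L)),
        ← Finset.mul_prod_erase _ _ hmem]
    rw [rowCoeff_eq_prod, rowCoeff_eq_prod, rowCoeff_eq_prod, hsplit, hsplit, hsplit, ha', ha2]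
    have hout : ∀ k ∈ (Finset.univ.erase (⟨μ i - 2, by omega⟩ : Fin L)).erase ⟨ν i - 1, by omega⟩,
        (k : ℕ) ≠ μ i - 2 ∧ (k : ℕ) ≠ ν i - 1 := by
      intro k hk
      simp only [Finset.mem_erase, Finset.mem_univ, and_true, ne_eq, Fin.ext_iff] at hk
      exact ⟨hk.2, hk.1⟩
    have hF : ∀ k ∈ (Finset.univ.erase (⟨μ i - 2, by omega⟩ : Fin L)).erase ⟨ν i - 1, by omega⟩,
        rowLevel q t (μ ∘ Equiv.swap i j) (ν ∘ Equiv.swap i j) k = rowLevel q t μ ν k :=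
      fun k hk => (hother k (hout k hk).1 (hout k hk).2).1
    have hH : ∀ k ∈ (Finset.univ.erase (⟨μ i - 2, by omega⟩ : Fin L)).erase ⟨ν i - 1, by omega⟩,
        rowLevel q t μ (ν ∘ Equiv.swap i j) k = rowLevel q t μ ν k :=
      fun k hk => (hother k (hout k hk).1 (hout k hk).2).2
    rw [Finset.prod_congr rfl hF, Finset.prod_congr rfl hH]
    linear_combination (- rowLevel q t μ ν (μ i - 2) *
      ∏ k ∈ (Finset.univ.erase (⟨μ i - 2, by omega⟩ : Fin L)).erase ⟨ν i - 1, by omega⟩,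
        rowLevel q t μ ν k) * hb
  · have hH : rowCoeff q t L μ (ν ∘ Equiv.swap i j) = rowCoeff q t L μ ν := by
      refine Finset.prod_congr rfl fun k _ => ?_
      by_cases hk : ν i = k + 1 ∨ ν j = k + 1
      · exact rowLevel_swap_top' ht hij (by omega) (by omega)
      · exact rowLevel_swap_top (by omega)
    rw [hH]
    have : rowCoeff q t L (μ ∘ Equiv.swap i j) (ν ∘ Equiv.swap i j) = t * rowCoeff q t L μ ν := by
      refine prod_eq_mul_prod (⟨μ i - 2, by omega⟩ : Fin L) ha' fun k hk => ?_
      have hk' : (k : ℕ) ≠ μ i - 2 := fun h => hk (Fin.ext h)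
      exact rowLevel_swap ht hij ⟨by omega, by omega, by omega⟩
    rw [this]
    ring

theorem rowCoeff_swap_zero_of_ge (ht : t ≠ 0) (hij : (j : ℕ) = i + 1) (h₀ : μ j = 0)
    (h₁ : μ i ≠ 0) (h₃ : ν j ≤ ν i) (h₄ : ν i ≤ L) :
    rowCoeff q t L (μ ∘ Equiv.swap i j) (ν ∘ Equiv.swap i j) = rowCoeff q t L μ ν := by
  by_cases hc : μ i ≤ ν i
  · rw [rowCoeff_eq_zero q t i h₄ h₁ hc, rowCoeff_eq_zero q t j] <;> simp <;> omega
  · refine Finset.prod_congr rfl fun k _ => ?_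
    exact rowLevel_swap ht hij ⟨by omega, by omega, by omega⟩

/-- Only the label `ν j + 1` can be affected. Its upper ball at `j` meets the lower ball at `i` as a
free ball that is not a partner if `μ i ≤ ν j`, and as a possible partner if `μ i = ν j + 1`.
Otherwise the lower ball is not free for it, and all three coefficients agree. -/
theorem rowCoeff_swap_zero_of_lt (ht : t ≠ 0) (hq : ∀ a b : ℕ, 1 - q ^ (a + 1) * t ^ b ≠ 0)
    (hij : (j : ℕ) = i + 1) (h₀ : μ j = 0) (h₁ : μ i ≠ 0) (h₃ : ν i < ν j) (h₄ : ν j ≤ L) :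
    rowCoeff q t L (μ ∘ Equiv.swap i j) (ν ∘ Equiv.swap i j) =
      (1 - t) * rowCoeff q t L μ (ν ∘ Equiv.swap i j) + t * rowCoeff q t L μ ν := by
  by_cases hci : μ i ≤ ν i
  · rw [rowCoeff_eq_zero q t i (by omega) h₁ hci, rowCoeff_eq_zero q t j,
      rowCoeff_eq_zero q t i, mul_zero, mul_zero, add_zero] <;> simp <;> omega
  by_cases hcj : μ i ≤ ν j
  · rw [rowCoeff_eq_zero q t (ν := ν ∘ Equiv.swap i j) i (by simpa using h₄) h₁ (by simpa using hcj),
      mul_zero, zero_add]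
    refine prod_eq_mul_prod (⟨ν j - 1, by omega⟩ : Fin L) ?_ fun k hk => ?_
    · have := rowLevel_swap_top_bottom (q := q) ht hij (μ := μ ∘ Equiv.swap i j)
        (ν := ν ∘ Equiv.swap i j) (k := ν j - 1) (by simp; omega) (by simp; omega)
        (by simp; omega) (by simp; omega)
      rwa [comp_swap_swap, comp_swap_swap] at this
    · have hk' : (k : ℕ) ≠ ν j - 1 := fun h => hk (Fin.ext h)
      exact rowLevel_swap ht hij ⟨by omega, by omega, by omega⟩
  have hother : ∀ k : ℕ, ν j ≠ k + 1 →
      rowLevel q t μ (ν ∘ Equiv.swap i j) k = rowLevel q t μ ν k := by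
    intro k hk
    by_cases hk3 : ν i = k + 1
    · exact rowLevel_swap_top' ht hij (by omega) (by omega)
    · exact rowLevel_swap_top (by omega)
  by_cases he : ν j = μ i - 1
  · have hb := rowLevel_swap_top_target ht hq hij (μ := μ ∘ Equiv.swap i j)
        (ν := ν ∘ Equiv.swap i j) (k := ν j - 1) (by simp; omega) (by simp; omega)
        (by simp; omega) (by simp; omega)
    have hb2 := rowLevel_swap (q := q) ht hij (μ := μ) (ν := ν ∘ Equiv.swap i j) (k := ν j - 1)
      ⟨by simp; omega, by simp; omega, by simp; omega⟩
    rw [comp_swap_swap] at hb2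
    rw [comp_swap_swap, comp_swap_swap, hb2] at hb
    have hsplit : ∀ f : ℕ → K, ∏ k : Fin L, f k = f (ν j - 1) *
        ∏ k ∈ Finset.univ.erase (⟨ν j - 1, by omega⟩ : Fin L), f k := by
      intro f
      rw [← Finset.mul_prod_erase _ _ (Finset.mem_univ (⟨ν j - 1, by omega⟩ : Fin L))]
    rw [rowCoeff_eq_prod, rowCoeff_eq_prod, rowCoeff_eq_prod, hsplit, hsplit, hsplit, hb]
    have hout : ∀ k ∈ Finset.univ.erase (⟨ν j - 1, by omega⟩ : Fin L), ν j ≠ (k : ℕ) + 1 := by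
      intro k hk
      simp only [Finset.mem_erase, Finset.mem_univ, and_true, ne_eq, Fin.ext_iff] at hk
      omega
    have hF : ∀ k ∈ Finset.univ.erase (⟨ν j - 1, by omega⟩ : Fin L),
        rowLevel q t (μ ∘ Equiv.swap i j) (ν ∘ Equiv.swap i j) k = rowLevel q t μ ν k := by
      intro k hk
      have := hout k hk
      exact rowLevel_swap ht hij ⟨by omega, by omega, by omega⟩
    have hH : ∀ k ∈ Finset.univ.erase (⟨ν j - 1, by omega⟩ : Fin L),
        rowLevel q t μ (ν ∘ Equiv.swap i j) k = rowLevel q t μ ν k :=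
      fun k hk => hother k (hout k hk)
    rw [Finset.prod_congr rfl hF, Finset.prod_congr rfl hH]
    ring
  · have hH : rowCoeff q t L μ (ν ∘ Equiv.swap i j) = rowCoeff q t L μ ν := by
      refine Finset.prod_congr rfl fun k _ => ?_
      by_cases hk : ν j = k + 1
      · exact rowLevel_swap_top' ht hij (by omega) (by omega)
      · exact hother k hk
    have hF : rowCoeff q t L (μ ∘ Equiv.swap i j) (ν ∘ Equiv.swap i j) = rowCoeff q t L μ ν := by
      refine Finset.prod_congr rfl fun k _ => ?_
      exact rowLevel_swap ht hij ⟨by omega, by omega, by omega⟩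
    rw [hH, hF]
    ring

theorem rowCoeff_swap_top (ht : t ≠ 0) (hij : (j : ℕ) = i + 1) (h : μ i = μ j) :
    rowCoeff q t L μ (ν ∘ Equiv.swap i j) = rowCoeff q t L μ ν :=
  Finset.prod_congr rfl fun k _ => rowLevel_swap_top' ht hij (by omega) (by omega)

end Swap

section Rotation

variable [NeZero n]

theorem rotateParts_map (P : ℕ → Prop) [DecidablePred P] (μ : Fin n → ℕ) :
    ({c | P (rotateParts μ c)} : Finset (Fin n)) =
      ({c | P (μ c)} : Finset (Fin n)).map (Equiv.addRight (1 : Fin n)).toEmbedding := by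
  ext x
  simp [rotateParts, sub_eq_add_neg]

/-- In the product of `levelWt_rotate` over the labels, the last column contributes once as an upper
ball, with `k + 1 = ν_n`, and once as a partner, with `k + 1 = μ_n - 1`. If `ν_n = 0` or `μ_n ≤ 1`,
the respective factor is absent, in agreement with truncated subtraction. -/
theorem rowCoeff_rotate {t : K} (ht : t ≠ 0) (q : K) {L : ℕ} {μ ν : Fin n → ℕ}
    (hμ : μ (0 - 1) ≤ L + 1) (hν : ν (0 - 1) ≤ L) :
    q ^ ν (0 - 1) * rowCoeff q t L (rotateParts μ) (rotateParts ν) =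
      q ^ (μ (0 - 1) - 1) * rowCoeff q t L μ ν := by
  have hlast : ∀ c : Fin n, c + 1 = 0 ↔ c = 0 - 1 := fun c => eq_sub_iff_add_eq.symm
  have hprod : ∀ (S : Finset (Fin n)) (z : K), (∏ c ∈ S, if c + 1 = 0 then z else 1) =
      if (0 - 1 : Fin n) ∈ S then z else 1 := by
    intro S z
    simp only [hlast]
    rw [Finset.prod_ite_eq']
  have hpow : ∀ m ≤ L, (∏ k : Fin L, if m = (k : ℕ) + 1 then q ^ ((k : ℕ) + 1) else 1) = q ^ m := by
    intro m hm
    rcases m with _ | m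
    · simp
    · rw [Finset.prod_eq_single (⟨m, hm⟩ : Fin L)]
      · simp
      · intro b _ hb
        rw [if_neg]
        intro h
        apply hb
        rw [Fin.ext_iff]
        change (b : ℕ) = m
        omega
      · simp
  have hlevel : ∀ k : Fin L,
      (if ν (0 - 1) = (k : ℕ) + 1 then q ^ ((k : ℕ) + 1) else 1) *
        levelWt (q ^ ((k : ℕ) + 1)) t (topLevel (rotateParts ν) k) (freeLevel (rotateParts μ) k)
          (botLevel (rotateParts μ) k) =
      (if μ (0 - 1) - 1 = (k : ℕ) + 1 then q ^ ((k : ℕ) + 1) else 1) *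
        levelWt (q ^ ((k : ℕ) + 1)) t (topLevel ν k) (freeLevel μ k) (botLevel μ k) := by
    intro k
    have := levelWt_rotate ht (q ^ ((k : ℕ) + 1)) (A := topLevel ν k) (botLevel_subset μ k)
    rw [hprod, hprod] at this
    simp only [mem_topLevel, mem_botLevel] at this
    unfold topLevel freeLevel botLevel at *
    rw [rotateParts_map (fun m => m = (k : ℕ) + 1), rotateParts_map (fun m => m = (k : ℕ) + 2),
      rotateParts_map (fun m => m ≠ 0 ∧ m ≤ (k : ℕ) + 2), this]
    have e : μ (0 - 1) - 1 = (k : ℕ) + 1 ↔ μ (0 - 1) = (k : ℕ) + 2 := by omega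
    simp only [e]
  have := Finset.prod_congr (rfl : (Finset.univ : Finset (Fin L)) = Finset.univ) fun k _ => hlevel k
  rw [Finset.prod_mul_distrib, Finset.prod_mul_distrib, hpow _ hν, hpow _ (by omega)] at this
  exact this

end Rotation

/-- A nonzero factor requires equally many upper balls and partners of its label. Hence the positive
values of `μ - 1` and of `ν` occur equally often. -/
theorem sum_eq_of_rowCoeff_ne_zero {q t : K} {L : ℕ} {μ ν : Fin n → ℕ} (hμ : ∀ c, μ c ≤ L + 1)
    (hν : ∀ c, ν c ≤ L) (h : rowCoeff q t L μ ν ≠ 0) :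
    ∑ c, μ c = ({c | μ c ≠ 0} : Finset (Fin n)).card + ∑ c, ν c := by
  have hcard : ∀ k : Fin L, (topLevel ν k).card = (botLevel μ k).card := by
    intro k
    by_contra hne
    exact h (Finset.prod_eq_zero (Finset.mem_univ k)
      (levelWt_eq_zero_of_card _ _ (botLevel_subset μ k) hne))
  have key : ∀ f : Fin n → ℕ, (∀ c, f c ≤ L) →
      ∑ c, f c = ∑ k : Fin L, ((k : ℕ) + 1) * ({c | f c = k + 1} : Finset (Fin n)).card := by
    intro f hf
    have : ∀ c, f c = ∑ k : Fin L, if f c = k + 1 then (k : ℕ) + 1 else 0 := by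
      intro c
      by_cases h0 : f c = 0
      · simp [h0]
      · have := hf c
        rw [Finset.sum_eq_single (⟨f c - 1, by omega⟩ : Fin L)]
        · rw [if_pos (by simp only; omega)]
          simp only
          omega
        · intro b _ hb
          rw [if_neg]
          intro h
          apply hb
          rw [Fin.ext_iff]
          simp only
          omega
        · simp
    rw [Finset.sum_congr rfl fun c _ => this c, Finset.sum_comm]
    refine Finset.sum_congr rfl fun k _ => ?_
    rw [← Finset.sum_filter, Finset.sum_const, smul_eq_mul, mul_comm]
  have hsplit : ∑ c, μ c = ({c | μ c ≠ 0} : Finset (Fin n)).card + ∑ c, (μ c - 1) := by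
    rw [Finset.card_filter, ← Finset.sum_add_distrib]
    refine Finset.sum_congr rfl fun c _ => ?_
    split_ifs <;> omega
  rw [hsplit, key ν hν, key (fun c => μ c - 1) fun c => by have := hμ c; omega]
  congr 1
  refine Finset.sum_congr rfl fun k _ => ?_
  have e : ({c | μ c - 1 = (k : ℕ) + 1} : Finset (Fin n)) = botLevel μ k := by
    refine Finset.filter_congr fun c _ => ?_
    omega
  rw [e, ← hcard k]
  rfl

end RowCoefficients

/-! ### The Hecke operator with denominators cleared. -/

section HeckeRelation

variable {K : Type*} [Field K] {n : ℕ}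

open MvPolynomial

/-- `g` is the image of `f` under the Hecke operator for the columns `i` and `j`, with
denominators cleared. -/
def HeckeRel (t : K) (i j : Fin n) (f g : MvPolynomial (Fin n) K) : Prop :=
  (X i - X j) * g =
    C t * (X i - X j) * f - (C t * X i - X j) * (f - rename (Equiv.swap i j) f)

variable {t : K} {i j : Fin n} {f g : MvPolynomial (Fin n) K}

theorem X_sub_X_ne_zero (hij : i ≠ j) : (X i - X j : MvPolynomial (Fin n) K) ≠ 0 := fun h =>
  hij (X_injective (sub_eq_zero.1 h))

theorem heckeT_eq [NeZero n] (hij : i ≠ i + 1) (h : HeckeRel t i (i + 1) f g) :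
    heckeT t i f = algebraMap _ _ g := by
  have hne : algebraMap (MvPolynomial (Fin n) K) (FractionRing (MvPolynomial (Fin n) K))
      (X i - X (i + 1)) ≠ 0 := fun h0 =>
    X_sub_X_ne_zero hij ((IsFractionRing.injective (MvPolynomial (Fin n) K)
      (FractionRing (MvPolynomial (Fin n) K))) (h0.trans (map_zero _).symm))
  have h' := congrArg (algebraMap (MvPolynomial (Fin n) K)
    (FractionRing (MvPolynomial (Fin n) K))) h
  simp only [heckeT, swapVars]
  rw [eq_comm, ← mul_right_inj' hne, ← map_mul, h']
  simp only [map_sub, map_mul] at hne ⊢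
  field_simp

/-- The relation T² = (t - 1)T + t. The reason is that `f + g` is symmetric in the two variables, so
T multiplies it by `t`. -/
theorem HeckeRel.quadratic (hij : i ≠ j) (h : HeckeRel t i j f g) :
    HeckeRel t i j g (C (t - 1) * g + C t * f) := by
  have hs := congrArg (rename (Equiv.swap i j)) h
  have hss : rename (Equiv.swap i j) (rename (Equiv.swap i j) f) = f := by
    rw [rename_rename]
    convert rename_id_apply f
    funext x; simp
  simp only [map_mul, map_sub, rename_X, rename_C, Equiv.swap_apply_left, Equiv.swap_apply_right,
    hss] at hs
  unfold HeckeRel at *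
  have hg : g - rename (Equiv.swap i j) g = rename (Equiv.swap i j) f - f := by
    refine mul_left_cancel₀ (X_sub_X_ne_zero (K := K) hij) ?_
    linear_combination h + hs
  rw [hg, map_sub, map_one]
  linear_combination -h

theorem HeckeRel.mul_of_symm {p : MvPolynomial (Fin n) K} (hp : rename (Equiv.swap i j) p = p)
    (h : HeckeRel t i j f g) : HeckeRel t i j (p * f) (p * g) := by
  unfold HeckeRel at *
  rw [map_mul, hp]
  linear_combination p * h

/-- The commutation rule T x_i = x_j (T + 1 - t), needed when exactly one of the two columns holds a
ball in the bottom row. -/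
theorem HeckeRel.X_mul (h : HeckeRel t i j f g) :
    HeckeRel t i j (X i * f) (X j * (g + C (1 - t) * f)) := by
  unfold HeckeRel at *
  rw [map_mul, rename_X, Equiv.swap_apply_left, map_sub, map_one]
  linear_combination X j * h

theorem HeckeRel.sum {ι : Type*} (S : Finset ι) (a : ι → K) {f g : ι → MvPolynomial (Fin n) K}
    (h : ∀ x ∈ S, HeckeRel t i j (f x) (g x)) :
    HeckeRel t i j (∑ x ∈ S, C (a x) * f x) (∑ x ∈ S, C (a x) * g x) := by
  unfold HeckeRel at *
  rw [map_sum, ← Finset.sum_sub_distrib, Finset.mul_sum, Finset.mul_sum, Finset.mul_sum,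
    ← Finset.sum_sub_distrib]
  refine Finset.sum_congr rfl fun x hx => ?_
  rw [map_mul, rename_C]
  linear_combination C (a x) * h x hx

theorem heckeRel_of_symm (h : rename (Equiv.swap i j) f = f) : HeckeRel t i j f (C t * f) := by
  unfold HeckeRel
  rw [h]
  ring

end HeckeRelation

/-! ### Induction on the number of rows. -/

section Families

variable {K : Type*} [Field K] {n : ℕ}

open MvPolynomial

theorem MultilineQueue.ball_nonempty {L : ℕ} (Q : MultilineQueue L n) {r : ℕ} (h₁ : 1 ≤ r)
    (h₂ : r ≤ L) : (Q.ball r).Nonempty := by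
  have key : ∀ k, k < L → (Q.ball (L - k)).Nonempty := by
    intro k
    induction k with
    | zero => exact fun h => Q.top_nonempty h
    | succ k ih =>
      intro hk
      have h := Finset.card_pos.2 (ih (by omega))
      have := Q.card_mono (L - (k + 1)) (by omega) (by omega)
      rw [show L - (k + 1) + 1 = L - k by omega] at this
      exact Finset.card_pos.1 (by omega)
  have := key (L - r) (by omega)
  rwa [show L - (L - r) = r by omega] at this

theorem rowsPoly_succ_zero (q t : K) (L : ℕ) {μ : Fin n → ℕ} (hμ : ∀ c, μ c = 0) :
    rowsPoly q t (L + 1) μ = 0 := by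
  unfold rowsPoly
  rw [Finset.filter_false_of_mem, Finset.sum_empty]
  intro Q _ h
  obtain ⟨c, hc⟩ := Q.ball_nonempty le_rfl (by omega : 1 ≤ L + 1)
  exact Q.label_ne_zero.2 hc (by rw [h c, hμ c])

theorem rowsPoly_zero (q t : K) (μ : Fin n → ℕ) :
    ∃ m : ℕ, rowsPoly q t 0 μ = (m : MvPolynomial (Fin n) K) := by
  refine ⟨({Q : MultilineQueue 0 n | Q.HasType μ} : Finset _).card, ?_⟩
  unfold rowsPoly
  rw [Finset.card_eq_sum_ones, Nat.cast_sum]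
  refine Finset.sum_congr rfl fun Q _ => ?_
  simp [MultilineQueue.wt, MultilineQueue.wtx, MultilineQueue.wtqt, MultilineQueue.colCount]

/-- The bounded compositions over which the recursion runs. -/
abbrev boundedParts (n L : ℕ) : Finset (Fin n → ℕ) :=
  Fintype.piFinset fun _ : Fin n => Finset.range (L + 1)

theorem mem_boundedParts {L : ℕ} {ν : Fin n → ℕ} : ν ∈ boundedParts n L ↔ ∀ c, ν c ≤ L := by
  simp [boundedParts, Fintype.mem_piFinset]

theorem sum_eq_zero_of_antisymm {M : Type*} [AddCommGroup M] {L : ℕ} {i j : Fin n}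
    (e : (Fin n → ℕ) → M) (h : ∀ ν ∈ boundedParts n L, ν i < ν j → e ν + e (ν ∘ Equiv.swap i j) = 0)
    (h₀ : ∀ ν ∈ boundedParts n L, ν i = ν j → e ν = 0) : ∑ ν ∈ boundedParts n L, e ν = 0 := by
  have hmem : ∀ ν ∈ boundedParts n L, ν ∘ Equiv.swap i j ∈ boundedParts n L := fun ν hν =>
    mem_boundedParts.2 fun c => mem_boundedParts.1 hν _
  refine Finset.sum_involution (fun ν _ => ν ∘ Equiv.swap i j) ?_ ?_ hmem fun ν _ => comp_swap_swap ν
  · intro ν hν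
    rcases lt_trichotomy (ν i) (ν j) with hlt | heq | hgt
    · exact h ν hν hlt
    · rw [h₀ ν hν heq, h₀ _ (hmem ν hν) (by simp [heq]), add_zero]
    · have := h _ (hmem ν hν) (by simpa using hgt)
      rwa [comp_swap_swap, add_comm] at this
  · intro ν hν hne he
    refine hne (h₀ ν hν ?_)
    have := congrFun he i
    simpa using this.symm

theorem sum_swap {M : Type*} [AddCommMonoid M] {L : ℕ} (i j : Fin n) (e : (Fin n → ℕ) → M) :
    ∑ ν ∈ boundedParts n L, e (ν ∘ Equiv.swap i j) = ∑ ν ∈ boundedParts n L, e ν := by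
  have hmem : ∀ ν ∈ boundedParts n L, ν ∘ Equiv.swap i j ∈ boundedParts n L := fun ν hν =>
    mem_boundedParts.2 fun c => mem_boundedParts.1 hν _
  exact Finset.sum_nbij' (fun ν => ν ∘ Equiv.swap i j) (fun ν => ν ∘ Equiv.swap i j) hmem hmem
    (fun ν _ => comp_swap_swap ν) (fun ν _ => comp_swap_swap ν) fun _ _ => rfl

theorem rename_prod_X (φ : Equiv.Perm (Fin n)) (S : Finset (Fin n)) :
    rename φ (∏ c ∈ S, X c : MvPolynomial (Fin n) K) = ∏ c ∈ S.map φ.toEmbedding, X c := by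
  rw [map_prod, Finset.prod_map]
  simp

section Exchange

variable {i j : Fin n} {q t : K}

/-- The exchange relations for multiline queues with `L` rows. -/
def ExchangeRel (q t : K) (i j : Fin n) (L : ℕ) : Prop :=
  ∀ μ : Fin n → ℕ, (∀ c, μ c ≤ L) →
    (μ j < μ i → HeckeRel t i j (rowsPoly q t L μ) (rowsPoly q t L (μ ∘ Equiv.swap i j))) ∧
    (μ i = μ j → HeckeRel t i j (rowsPoly q t L μ) (C t * rowsPoly q t L μ))

/-- The image of `rowsPoly` under the Hecke operator. -/
noncomputable def heckeImage (q t : K) (i j : Fin n) (L : ℕ) (ν : Fin n → ℕ) :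
    MvPolynomial (Fin n) K :=
  if ν j < ν i then rowsPoly q t L (ν ∘ Equiv.swap i j)
  else if ν i = ν j then C t * rowsPoly q t L ν
  else C (t - 1) * rowsPoly q t L ν + C t * rowsPoly q t L (ν ∘ Equiv.swap i j)

/-- If `ν i < ν j`, the polynomial of `ν` is itself the image under T of that of the exchanged
composition, and the quadratic relation applies. -/
theorem heckeRel_heckeImage {L : ℕ} (hij : i ≠ j) (h : ExchangeRel q t i j L) {ν : Fin n → ℕ}
    (hν : ∀ c, ν c ≤ L) : HeckeRel t i j (rowsPoly q t L ν) (heckeImage q t i j L ν) := by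
  unfold heckeImage
  split_ifs with h1 h2
  · exact (h ν hν).1 h1
  · exact (h ν hν).2 h2
  · have := (h (ν ∘ Equiv.swap i j) fun c => hν _).1 (by simp; omega)
    rw [comp_swap_swap] at this
    exact this.quadratic hij

theorem heckeImage_of_lt {L : ℕ} {ν : Fin n → ℕ} (h : ν i < ν j) :
    heckeImage q t i j L ν =
      C (t - 1) * rowsPoly q t L ν + C t * rowsPoly q t L (ν ∘ Equiv.swap i j) := by
  rw [heckeImage, if_neg h.not_gt, if_neg h.ne]

theorem heckeImage_of_eq {L : ℕ} {ν : Fin n → ℕ} (h : ν i = ν j) :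
    heckeImage q t i j L ν = C t * rowsPoly q t L ν := by
  rw [heckeImage, if_neg h.not_gt, if_pos h]

theorem heckeImage_swap_of_lt {L : ℕ} {ν : Fin n → ℕ} (h : ν i < ν j) :
    heckeImage q t i j L (ν ∘ Equiv.swap i j) = rowsPoly q t L ν := by
  rw [heckeImage, if_pos (by simpa using h), comp_swap_swap]

theorem comp_swap_of_eq {ν : Fin n → ℕ} (h : ν i = ν j) : ν ∘ Equiv.swap i j = ν := by
  funext x
  simp only [Function.comp_apply, Equiv.swap_apply_def]
  split_ifs with h1 h2
  · rw [h1, h]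
  · rw [h2, h]
  · rfl

/-- T is applied to each term of the recursion by the induction hypothesis. The two sides agree
already on each orbit of compositions under the exchange, by the relations for `rowCoeff`. -/
theorem exchangeRel (ht : t ≠ 0) (hq : ∀ a b : ℕ, 1 - q ^ (a + 1) * t ^ b ≠ 0)
    (hij : (j : ℕ) = i + 1) (L : ℕ) : ExchangeRel q t i j L := by
  have hne : i ≠ j := by rw [ne_eq, Fin.ext_iff]; omega
  induction L with
  | zero =>
    intro μ hμ
    have hi := hμ i
    have hj := hμ j
    refine ⟨fun h => by omega, fun _ => ?_⟩
    obtain ⟨m, hm⟩ := rowsPoly_zero q t μ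
    refine heckeRel_of_symm ?_
    rw [hm, map_natCast]
  | succ L ih =>
    intro μ hμ
    by_cases h0 : ∀ c, μ c = 0
    · refine ⟨fun h => ?_, fun _ => heckeRel_of_symm ?_⟩
      · rw [h0 i, h0 j] at h; omega
      · rw [rowsPoly_succ_zero q t L h0, map_zero]
    push Not at h0
    have h0' : ∃ c, (μ ∘ Equiv.swap i j) c ≠ 0 := by
      obtain ⟨c, hc⟩ := h0
      exact ⟨Equiv.swap i j c, by simpa using hc⟩
    have hsum : HeckeRel t i j
        (∑ ν ∈ boundedParts n L, C (rowCoeff q t L μ ν) * rowsPoly q t L ν)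
        (∑ ν ∈ boundedParts n L, C (rowCoeff q t L μ ν) * heckeImage q t i j L ν) :=
      HeckeRel.sum _ _ fun ν hν => heckeRel_heckeImage hne ih (mem_boundedParts.1 hν)
    have hsymm : (μ i ≠ 0 ↔ μ j ≠ 0) →
        rename (Equiv.swap i j) (∏ c with μ c ≠ 0, X c : MvPolynomial (Fin n) K) =
          ∏ c with μ c ≠ 0, X c := by
      intro h
      rw [rename_prod_X]
      congr 1
      exact swapSet_eq_self (by simpa using h)
    refine ⟨fun h => ?_, fun h => ?_⟩
    · rw [rowsPoly_succ q ht h0 hμ, rowsPoly_succ q ht h0' fun c => hμ _,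
        ← sum_swap i j fun ν => C (rowCoeff q t L (μ ∘ Equiv.swap i j) ν) * rowsPoly q t L ν]
      -- For `μ j = 0` the monomial is `X i` times a symmetric one, and moving T past `X i` adds a
      -- multiple `1 - t` of the sum. Otherwise the monomial is symmetric.
      by_cases hj : μ j = 0
      · have hi : μ i ≠ 0 := by omega
        have e1 : (∏ c with μ c ≠ 0, X c : MvPolynomial (Fin n) K) =
            X i * ∏ c with c ≠ i ∧ c ≠ j ∧ μ c ≠ 0, X c := by
          rw [← Finset.prod_insert (by simp)]
          congr 1
          ext c
          simp only [Finset.mem_filter, Finset.mem_univ, true_and, Finset.mem_insert]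
          by_cases h1 : c = i
          · simp [h1, hi]
          · by_cases h2 : c = j
            · simp [h2, hj, hne.symm]
            · simp [h1, h2]
        have e2 : (∏ c with (μ ∘ Equiv.swap i j) c ≠ 0, X c : MvPolynomial (Fin n) K) =
            X j * ∏ c with c ≠ i ∧ c ≠ j ∧ μ c ≠ 0, X c := by
          rw [← Finset.prod_insert (by simp)]
          congr 1
          ext c
          simp only [Finset.mem_filter, Finset.mem_univ, true_and, Finset.mem_insert,
            Function.comp_apply]
          by_cases h1 : c = i
          · simp [h1, hj, hne]
          · by_cases h2 : c = j
            · simp [h2, hi]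
            · simp [h1, h2, Equiv.swap_apply_of_ne_of_ne h1 h2]
        have hp : rename (Equiv.swap i j)
            (∏ c with c ≠ i ∧ c ≠ j ∧ μ c ≠ 0, X c : MvPolynomial (Fin n) K) =
            ∏ c with c ≠ i ∧ c ≠ j ∧ μ c ≠ 0, X c := by
          rw [rename_prod_X]
          congr 1
          exact swapSet_eq_self (by simp)
        rw [e1, e2, mul_assoc, mul_assoc]
        convert (hsum.mul_of_symm hp).X_mul using 2
        rw [← mul_assoc (C (1 - t)), mul_comm (C (1 - t)), mul_assoc, ← mul_add]
        congr 1
        rw [Finset.mul_sum, ← Finset.sum_add_distrib, eq_comm, ← sub_eq_zero,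
          ← Finset.sum_sub_distrib]
        refine sum_eq_zero_of_antisymm (i := i) (j := j) _ (fun ν hν hlt => ?_) fun ν hν heq => ?_
        · rw [mem_boundedParts] at hν
          rw [heckeImage_of_lt hlt, heckeImage_swap_of_lt hlt,
            rowCoeff_swap_zero_of_lt ht hq hij hj hi hlt (hν j),
            rowCoeff_swap_zero_of_ge ht hij hj hi (by simpa using hlt.le) (by simpa using hν j)]
          simp only [comp_swap_swap, map_add, map_mul, map_sub, map_one]
          ring
        · rw [mem_boundedParts] at hν
          rw [heckeImage_of_eq heq,
            rowCoeff_swap_zero_of_ge ht hij hj hi heq.ge (hν i), comp_swap_of_eq heq]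
          simp only [map_sub, map_one]
          ring
      · have hi : μ i ≠ 0 := by omega
        have e2 : (∏ c with (μ ∘ Equiv.swap i j) c ≠ 0, X c : MvPolynomial (Fin n) K) =
            ∏ c with μ c ≠ 0, X c := by
          refine Finset.prod_congr (Finset.filter_congr fun c _ => ?_) fun _ _ => rfl
          simp only [Function.comp_apply, Equiv.swap_apply_def]
          split_ifs with h1 h2
          · simp [h1, hi, hj]
          · simp [h2, hi, hj]
          · rfl
        rw [e2]
        convert hsum.mul_of_symm (hsymm (by simp [hi, hj])) using 2
        rw [eq_comm, ← sub_eq_zero, ← Finset.sum_sub_distrib]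
        refine sum_eq_zero_of_antisymm (i := i) (j := j) _ (fun ν hν hlt => ?_) fun ν hν heq => ?_
        · rw [mem_boundedParts] at hν
          rw [heckeImage_of_lt hlt, heckeImage_swap_of_lt hlt,
            rowCoeff_swap_of_le ht hij hj h (hμ i) hlt.le (hν j),
            rowCoeff_swap_of_gt ht hq hij hj h (hμ i) (by simpa using hlt) (by simpa using hν j)]
          simp only [comp_swap_swap, map_add, map_mul, map_sub, map_one]
          ring
        · rw [mem_boundedParts] at hν
          rw [heckeImage_of_eq heq,
            rowCoeff_swap_of_le ht hij hj h (hμ i) heq.le (hν j), comp_swap_of_eq heq]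
          simp only [map_mul]
          ring
    · rw [rowsPoly_succ q ht h0 hμ]
      convert hsum.mul_of_symm (hsymm (by rw [h])) using 1
      rw [mul_left_comm]
      congr 1
      rw [Finset.mul_sum, eq_comm, ← sub_eq_zero, ← Finset.sum_sub_distrib]
      refine sum_eq_zero_of_antisymm (i := i) (j := j) _ (fun ν hν hlt => ?_) fun ν hν heq => ?_
      · rw [heckeImage_of_lt hlt, heckeImage_swap_of_lt hlt, rowCoeff_swap_top ht hij h]
        simp only [map_sub, map_one]
        ring
      · rw [heckeImage_of_eq heq]
        ring

end Exchange

/-! ### The cyclic relation. -/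

section Cyclic

variable [NeZero n] {q t : K}

theorem shiftVars_C (q a : K) : shiftVars q (C a : MvPolynomial (Fin n) K) = C a := by
  simp [shiftVars, algebraMap_eq]

theorem shiftVars_mul (q : K) (f g : MvPolynomial (Fin n) K) :
    shiftVars q (f * g) = shiftVars q f * shiftVars q g := by
  simp [shiftVars]

theorem shiftVars_sum {ι : Type*} (q : K) (S : Finset ι) (f : ι → MvPolynomial (Fin n) K) :
    shiftVars q (∑ x ∈ S, f x) = ∑ x ∈ S, shiftVars q (f x) := by
  simp [shiftVars]

/-- The truncated difference in the exponent is `1` if the last part is positive and `0` otherwise.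
-/
theorem shiftVars_prod (q : K) (μ : Fin n → ℕ) :
    shiftVars q (∏ c with rotateParts μ c ≠ 0, X c : MvPolynomial (Fin n) K) =
      C (q ^ (μ (0 - 1) - (μ (0 - 1) - 1))) * (∏ c with μ c ≠ 0, X c) := by
  rw [rotateParts_map (fun m => m ≠ 0), shiftVars, map_prod, Finset.prod_map]
  have h : ∀ c : Fin n, (aeval fun j : Fin n => if j = 0 then C q * X (j - 1)
      else (X (j - 1) : MvPolynomial (Fin n) K))
        (X ((Equiv.addRight (1 : Fin n)).toEmbedding c) : MvPolynomial (Fin n) K) =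
      (if c = 0 - 1 then C q else 1) * X c := by
    intro c
    have e : c = 0 - 1 ↔ c + 1 = 0 := eq_sub_iff_add_eq
    rw [aeval_X]
    simp only [Equiv.coe_toEmbedding, Equiv.coe_addRight, add_sub_cancel_right, e]
    split_ifs
    · rfl
    · rw [one_mul]
  rw [Finset.prod_congr rfl fun c _ => h c, Finset.prod_mul_distrib, Finset.prod_ite_eq']
  congr 1
  simp only [Finset.mem_filter, Finset.mem_univ, true_and]
  split_ifs with h0
  · rw [show μ (0 - 1) - (μ (0 - 1) - 1) = 1 by omega, pow_one]
  · rw [show μ (0 - 1) - (μ (0 - 1) - 1) = 0 by omega, pow_zero, C_1]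

theorem sum_rotate {M : Type*} [AddCommMonoid M] {L : ℕ} (e : (Fin n → ℕ) → M) :
    ∑ ν ∈ boundedParts n L, e (rotateParts ν) = ∑ ν ∈ boundedParts n L, e ν := by
  refine Finset.sum_nbij' rotateParts (fun ν c => ν (c + 1)) ?_ ?_ ?_ ?_ fun _ _ => rfl
  · exact fun ν hν => mem_boundedParts.2 fun c => mem_boundedParts.1 hν _
  · exact fun ν hν => mem_boundedParts.2 fun c => mem_boundedParts.1 hν _
  · intro ν _; funext c; simp [rotateParts]
  · intro ν _; funext c; simp [rotateParts]

theorem rowsPoly_rotate (ht : t ≠ 0) (L : ℕ) : ∀ μ : Fin n → ℕ, (∀ c, μ c ≤ L) →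
    C (q ^ μ (0 - 1)) * rowsPoly q t L μ = shiftVars q (rowsPoly q t L (rotateParts μ)) := by
  induction L with
  | zero =>
    intro μ hμ
    have h : rotateParts μ = μ := by
      funext c
      exact (Nat.le_zero.1 (hμ _)).trans (Nat.le_zero.1 (hμ _)).symm
    obtain ⟨m, hm⟩ := rowsPoly_zero q t μ
    rw [h, hm, Nat.le_zero.1 (hμ _)]
    simp [shiftVars]
  | succ L ih =>
    intro μ hμ
    by_cases h0 : ∀ c, μ c = 0
    · rw [rowsPoly_succ_zero q t L h0, rowsPoly_succ_zero q t L (μ := rotateParts μ) fun c => h0 _]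
      simp [shiftVars]
    push Not at h0
    have h0' : ∃ c, rotateParts μ c ≠ 0 := by
      obtain ⟨c, hc⟩ := h0
      exact ⟨c + 1, by simpa [rotateParts] using hc⟩
    rw [rowsPoly_succ q ht h0 hμ, rowsPoly_succ q ht h0' fun c => hμ _, shiftVars_mul,
      shiftVars_prod, shiftVars_sum,
      ← sum_rotate fun ν => shiftVars q (C (rowCoeff q t L (rotateParts μ) ν) * rowsPoly q t L ν)]
    -- The factor `q ^ ν (0 - 1)` of the induction hypothesis is the one that `rowCoeff_rotate`
    -- trades for `q ^ (μ (0 - 1) - 1)`.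
    have hterm : ∀ ν ∈ boundedParts n L,
        shiftVars q (C (rowCoeff q t L (rotateParts μ) (rotateParts ν)) *
          rowsPoly q t L (rotateParts ν)) =
        C (q ^ (μ (0 - 1) - 1)) * (C (rowCoeff q t L μ ν) * rowsPoly q t L ν) := by
      intro ν hν
      rw [mem_boundedParts] at hν
      rw [shiftVars_mul, shiftVars_C, ← ih ν hν, ← mul_assoc, ← mul_assoc, ← C_mul, ← C_mul,
        mul_comm (rowCoeff _ _ _ _ _), rowCoeff_rotate ht q (hμ _) (hν _)]
    rw [Finset.sum_congr rfl hterm, ← Finset.mul_sum]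
    have hpow : q ^ μ (0 - 1) = q ^ (μ (0 - 1) - (μ (0 - 1) - 1)) * q ^ (μ (0 - 1) - 1) := by
      rw [← pow_add]
      congr 1
      omega
    rw [hpow, C_mul]
    ring

end Cyclic

theorem rowsPoly_isHomogeneous {q t : K} (ht : t ≠ 0) (L : ℕ) : ∀ μ : Fin n → ℕ,
    (∀ c, μ c ≤ L) → (rowsPoly q t L μ).IsHomogeneous (∑ c, μ c) := by
  induction L with
  | zero =>
    intro μ hμ
    obtain ⟨m, hm⟩ := rowsPoly_zero q t μ
    rw [hm, Finset.sum_eq_zero fun c _ => Nat.le_zero.1 (hμ c), ← map_natCast C]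
    exact isHomogeneous_C _ _
  | succ L ih =>
    intro μ hμ
    by_cases h0 : ∀ c, μ c = 0
    · rw [rowsPoly_succ_zero q t L h0]
      exact isHomogeneous_zero _ _ _
    push Not at h0
    have hcard : ({c | μ c ≠ 0} : Finset (Fin n)).card ≤ ∑ c, μ c := by
      rw [Finset.card_filter]
      refine Finset.sum_le_sum fun c _ => ?_
      split_ifs <;> omega
    rw [rowsPoly_succ q ht h0 hμ, ← Nat.add_sub_cancel' hcard]
    refine IsHomogeneous.mul ?_ (IsHomogeneous.sum _ _ _ fun ν hν => ?_)
    · rw [Finset.card_eq_sum_ones]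
      exact IsHomogeneous.prod _ _ _ fun c _ => isHomogeneous_X _ _
    · rw [Fintype.mem_piFinset] at hν
      have hν' : ∀ c, ν c ≤ L := fun c => Nat.lt_succ_iff.1 (Finset.mem_range.1 (hν c))
      by_cases hz : rowCoeff q t L μ ν = 0
      · rw [hz, C_0, zero_mul]
        exact isHomogeneous_zero _ _ _
      · rw [sum_eq_of_rowCoeff_ne_zero hμ hν' hz, Nat.add_sub_cancel_left,
          ← Nat.zero_add (∑ c, ν c)]
        exact (isHomogeneous_C _ _).mul (ih ν hν')

end Families

/-! ### Specialization to the largest part and to the field ℚ(q, t). -/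

section Main

variable {K : Type*} [Field K] {n : ℕ} {q t : K}

theorem mlqPoly_eq_rowsPoly (q t : K) (μ : Fin n → ℕ) :
    mlqPoly q t μ = rowsPoly q t (Finset.univ.sup μ) μ := rfl

theorem sup_comp_perm (μ : Fin n → ℕ) (φ : Equiv.Perm (Fin n)) :
    Finset.univ.sup (μ ∘ φ) = Finset.univ.sup μ := by
  refine le_antisymm (Finset.sup_le fun c _ => Finset.le_sup (Finset.mem_univ (φ c)))
    (Finset.sup_le fun c _ => ?_)
  have := Finset.le_sup (f := μ ∘ φ) (Finset.mem_univ (φ.symm c))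
  simpa using this

/-- A rearrangement has the same largest part, so the relations compare multiline queues with
equally many rows. -/
theorem mlqPoly_comp_perm (μ : Fin n → ℕ) (φ : Equiv.Perm (Fin n)) :
    mlqPoly q t (μ ∘ φ) = rowsPoly q t (Finset.univ.sup μ) (μ ∘ φ) := by
  rw [mlqPoly_eq_rowsPoly, sup_comp_perm]

theorem mlqPoly_isHomogeneous (ht : t ≠ 0) (μ : Fin n → ℕ) :
    (mlqPoly q t μ).IsHomogeneous (∑ c, μ c) :=
  rowsPoly_isHomogeneous ht _ μ fun c => Finset.le_sup (Finset.mem_univ c)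

variable [NeZero n]

theorem val_add_one {i : Fin n} (hi : (i : ℕ) + 1 < n) : ((i + 1 : Fin n) : ℕ) = i + 1 :=
  Fin.val_add_one_of_lt' hi

theorem heckeT_mlqPoly_of_gt (ht : t ≠ 0) (hq : ∀ a b : ℕ, 1 - q ^ (a + 1) * t ^ b ≠ 0)
    (μ : Fin n → ℕ) (i : Fin n) (hi : (i : ℕ) + 1 < n) (h : μ (i + 1) < μ i) :
    heckeT t i (mlqPoly q t μ) = algebraMap _ _ (mlqPoly q t (swapParts i μ)) := by
  have hij := val_add_one hi
  rw [swapParts, mlqPoly_comp_perm]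
  refine heckeT_eq (by rw [ne_eq, Fin.ext_iff]; omega) ?_
  exact ((exchangeRel ht hq hij _) μ fun c => Finset.le_sup (Finset.mem_univ c)).1 h

theorem heckeT_mlqPoly_of_eq (ht : t ≠ 0) (hq : ∀ a b : ℕ, 1 - q ^ (a + 1) * t ^ b ≠ 0)
    (μ : Fin n → ℕ) (i : Fin n) (hi : (i : ℕ) + 1 < n) (h : μ i = μ (i + 1)) :
    heckeT t i (mlqPoly q t μ) = algebraMap _ _ (MvPolynomial.C t * mlqPoly q t μ) := by
  have hij := val_add_one hi
  refine heckeT_eq (by rw [ne_eq, Fin.ext_iff]; omega) ?_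
  exact ((exchangeRel ht hq hij _) μ fun c => Finset.le_sup (Finset.mem_univ c)).2 h

theorem mlqPoly_rotate (ht : t ≠ 0) (μ : Fin n → ℕ) :
    MvPolynomial.C (q ^ μ (0 - 1)) * mlqPoly q t μ =
      shiftVars q (mlqPoly q t (rotateParts μ)) := by
  have h : rotateParts μ = μ ∘ Equiv.subRight (1 : Fin n) := rfl
  rw [h, mlqPoly_comp_perm, ← h]
  exact rowsPoly_rotate ht _ μ fun c => Finset.le_sup (Finset.mem_univ c)

end Main

theorem tVar_ne_zero : tVar ≠ 0 := by
  unfold tVar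
  rw [ne_eq, map_eq_zero_iff _ (IsFractionRing.injective _ _)]
  exact MvPolynomial.X_ne_zero _

theorem one_sub_qVar_tVar_ne_zero (a b : ℕ) : 1 - qVar ^ (a + 1) * tVar ^ b ≠ 0 := by
  unfold qVar tVar
  rw [← map_pow, ← map_pow, ← map_mul, ← map_one (algebraMap (MvPolynomial (Fin 2) ℚ) QTField),
    ← map_sub, ne_eq, map_eq_zero_iff _ (IsFractionRing.injective _ _)]
  intro h
  -- At q = t = 0 the polynomial takes the value 1, since q occurs with the positive exponent `a +
  -- 1`.
  have := congrArg (MvPolynomial.eval fun _ => (0 : ℚ)) h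
  simp at this

/-- The index `0 - 1 : Fin n` is the last one. The first conjunct says that the `F_μ` form a qKZ
family for every partition; the other three are its relations, spelled out for every composition. -/
theorem theorem1p19 (n : ℕ) [NeZero n] :
    (∀ lam : Fin n → ℕ, Antitone lam →
      IsQKZFamily qVar tVar lam (fun μ => mlqPoly qVar tVar μ)) ∧
    (∀ (μ : Fin n → ℕ) (i : Fin n), (i : ℕ) + 1 < n → μ (i + 1) < μ i →
      heckeT tVar i (mlqPoly qVar tVar μ) =
        algebraMap _ _ (mlqPoly qVar tVar (swapParts i μ))) ∧
    (∀ (μ : Fin n → ℕ) (i : Fin n), (i : ℕ) + 1 < n → μ i = μ (i + 1) →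
      heckeT tVar i (mlqPoly qVar tVar μ) =
        algebraMap _ _ (MvPolynomial.C tVar * mlqPoly qVar tVar μ)) ∧
    (∀ μ : Fin n → ℕ,
      MvPolynomial.C (qVar ^ μ (0 - 1)) * mlqPoly qVar tVar μ =
        shiftVars qVar (mlqPoly qVar tVar (rotateParts μ))) := by
  have ht := tVar_ne_zero
  have hq := one_sub_qVar_tVar_ne_zero
  refine ⟨fun lam _ => ⟨fun σ => ?_, fun _ μ _ => heckeT_mlqPoly_of_gt ht hq μ,
    fun _ μ _ => heckeT_mlqPoly_of_eq ht hq μ, fun _ μ _ => mlqPoly_rotate ht μ⟩,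
    heckeT_mlqPoly_of_gt ht hq, heckeT_mlqPoly_of_eq ht hq, mlqPoly_rotate ht⟩
  have := mlqPoly_isHomogeneous (q := qVar) ht (lam ∘ σ)
  rwa [show ∑ c, (lam ∘ σ) c = ∑ c, lam c from Equiv.sum_comp σ lam] at this
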